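/- Let $n\ge 1$. A subring of $\mathbb Z^n$ is a finite index subgroup $R\subseteq\mathbb Z^n$ that is closed under componentwise multiplication and contains $(1,\ldots,1)$. Its corank is the rank of the finite abelian group $\mathbb Z^n/R$, i.e. the number of invariant factors of $\mathbb Z^n/R$ that are greater than $1$. For an integer $k\ge 0$ and real $X$ let $$H_{n,k}(X)=\#\{R\subseteq\mathbb Z^n \text{ a subring}: [\mathbb Z^n:R]<X \text{ and } R \text{ has corank at most } k\},$$ and for $n \ge 2$ let $$a(n)=\max_{0\le d\le n-1}\left(\frac{d(n-1-d)}{n-1+d}+\frac{1}{n-1+d}\right),$$ the maximum being over integers $d$. (1) For all integers $n\ge 1$ and $k\ge 4$ and every $\epsilon>0$, $$H_{n,k}(X)=O\left(X^{\frac k2-\frac23+\epsilon}\right)\quad\text{as } X\to\infty,$$ where the implied constant depends on $n$, $k$ and $\epsilon$. (2) For all integers $n\ge 7$ and $k\ge 0$ with $k\le(6-4\sqrt2)\,n+2\sqrt2-\frac83$, $$\lim_{X\to\infty}\frac{H_{n,k}(X)}{X^{a(n)}}=0.$$ -/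

import Mathlib

open Filter Topology Asymptotics

/-- The finite abelian group `G` has rank `r`: its invariant factor decomposition
`G ≅ ℤ/α₁ ⊕ ⋯ ⊕ ℤ/αᵣ` (with `αᵢ₊₁ ∣ αᵢ`) has exactly `r` factors `αᵢ > 1`.
(Infinite groups do not satisfy this for any `r`.) -/
def HasInvariantFactorRank (G : Type*) [AddCommGroup G] (r : ℕ) : Prop :=
  ∃ α : Fin r → ℕ, (∀ i, 1 < α i) ∧ (∀ i j, i ≤ j → α j ∣ α i) ∧
    Nonempty (G ≃+ ((i : Fin r) → ZMod (α i)))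

/-- The sublattice `L ⊆ ℤⁿ` has corank at most `k`: the quotient `ℤⁿ / L` has rank `r` for
some `r ≤ k`. -/
def CorankAtMost {n : ℕ} (L : AddSubgroup (Fin n → ℤ)) (k : ℕ) : Prop :=
  ∃ r ≤ k, HasInvariantFactorRank ((Fin n → ℤ) ⧸ L) r

/-- The finite index subrings `R ⊆ ℤⁿ` (containing `(1, …, 1)`) with `[ℤⁿ : R] < X` and corank at
most `k`. Mathlib's index is `0` when it is infinite, hence the first condition. -/
def corankSubrings (n k : ℕ) (X : ℝ) : Set (Subring (Fin n → ℤ)) :=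
  {R | R.toAddSubgroup.index ≠ 0 ∧ (R.toAddSubgroup.index : ℝ) < X ∧
    CorankAtMost R.toAddSubgroup k}

/-- There are only finitely many such subrings, so that counting them by `Set.ncard` makes sense. -/
theorem corankSubrings_finite (n k : ℕ) (X : ℝ) : (corankSubrings n k X).Finite := by
  obtain ⟨N, hN⟩ := exists_nat_gt X
  have hM : ∀ R ∈ corankSubrings n k X, ∀ x : Fin n → ℤ, N.factorial • x ∈ R := by
    rintro R ⟨h0, hlt, -⟩ x
    have hle : R.toAddSubgroup.index ≤ N := by
      exact_mod_cast (hlt.trans hN).le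
    obtain ⟨c, hc⟩ := Nat.dvd_factorial (Nat.pos_of_ne_zero h0) hle
    have hx : R.toAddSubgroup.index • x ∈ R := R.toAddSubgroup.nsmul_index_mem x
    rw [hc, mul_comm, mul_smul]
    exact R.nsmul_mem hx c
  have : NeZero N.factorial := ⟨N.factorial_ne_zero⟩
  let π : (Fin n → ℤ) → (Fin n → ZMod N.factorial) := fun x i => (x i : ZMod N.factorial)
  have key : ∀ R ∈ corankSubrings n k X, ∀ S ∈ corankSubrings n k X,
      π '' (R : Set (Fin n → ℤ)) = π '' (S : Set (Fin n → ℤ)) → R ≤ S := by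
    intro R _ S hS h x hx
    have hx' : π x ∈ π '' (S : Set (Fin n → ℤ)) := h ▸ Set.mem_image_of_mem π hx
    obtain ⟨s, hs, hsx⟩ := hx'
    have hdvd : ∀ i, (N.factorial : ℤ) ∣ x i - s i := fun i =>
      (ZMod.intCast_eq_intCast_iff_dvd_sub _ _ _).1 (congrFun hsx i)
    choose y hy using hdvd
    have hxy : x = s + N.factorial • y := by
      funext i
      have := hy i
      change x i = s i + N.factorial • y i
      rw [nsmul_eq_mul]
      linarith
    rw [hxy]
    exact S.add_mem hs (hM S hS y)
  refine Set.Finite.of_finite_image (f := fun R : Subring (Fin n → ℤ) =>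
    π '' (R : Set (Fin n → ℤ))) (Set.toFinite _) ?_
  intro R hR S hS h
  exact le_antisymm (key R hR S hS h) (key S hS R hR h.symm)

/-- `H_{n,k}(X)`: the number of subrings of `ℤⁿ` of index less than `X` and corank at most `k`. -/
noncomputable def subringCount (n k : ℕ) (X : ℝ) : ℕ := (corankSubrings n k X).ncard

/-- `a(n) = max_{0 ≤ d ≤ n-1} (d(n-1-d)/(n-1+d) + 1/(n-1+d))`, for `n ≥ 2`. -/
noncomputable def ishamExponent (n : ℕ) : ℝ :=
  ⨆ d : Fin n, ((d : ℝ) * ((n : ℝ) - 1 - d) / ((n : ℝ) - 1 + d) + 1 / ((n : ℝ) - 1 + d))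

/-! Counting subrings of index `m` is submultiplicative over coprime factors of `m`, so the heart of
the matter is index `p ^ e`. There the coordinates fall into classes, two being equivalent when they
agree mod `p` on all of `R`, and `R` contains every vector constant on classes. Splitting these off
leaves a multiplicative sublattice `S` of `p ℤ ^ j`, and `j ≤ k` because `ℤⁿ / R` surjects onto `𝔽_p
^ j`.

Give `S` a triangular basis with diagonal `p ^ a i`. Then `S` amounts to its projection `S'` away
from the first coordinate together with a ring homomorphism `S' → ℤ / p ^ a 0`, so the task is to
count homomorphisms from a sublattice of `ℤ ^ N` to `ℤ / p ^ b`. Adjoining generators one at a time,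
each image solves a monic quadratic, which gives `(2 p ^ (b / 2)) ^ N` (`cardLE_hom`). On the other
hand every homomorphism is `p`-adically close to a coordinate projection or to zero, which gives `2
^ N p ^ (N T)` with `T` the sum of the diagonal exponents, independently of `b`
(`cardLE_hom_of_hasDiagonal`). The first bound alone leads to the exponent `(k - 1) / 2`; combining
the two, which cross at `b = 2 T`, saves `1 / 6` and gives `k / 2 - 2 / 3`.

The local bounds have the shape `D (e + 1) ^ k p ^ (s e - 1)`. The factor `p⁻¹` makes the Euler
product converge at every exponent `s + ε`, and Rankin's trick converts this to `O(X ^ (s + ε))`.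
For (2), `a(n) ≥ (3 - 2√2)(n - 1)`, which under the hypothesis exceeds `k / 2 - 2 / 3` by at least
`√2 - 1`; only `k ≤ 3` needs separate care. -/

/-! ### Calculus of cardinality bounds. -/

/-- The set `s` is finite with at most `B` elements. -/
def CardLE {α : Type*} (s : Set α) (B : ℝ) : Prop := s.Finite ∧ (s.ncard : ℝ) ≤ B

namespace CardLE

variable {α β : Type*} {s t : Set α} {A B : ℝ}

theorem mono (h : CardLE s A) (hAB : A ≤ B) : CardLE s B := ⟨h.1, h.2.trans hAB⟩

theorem subset (h : CardLE t A) (hst : s ⊆ t) : CardLE s A :=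
  ⟨h.1.subset hst, le_trans (by exact_mod_cast Set.ncard_le_ncard hst h.1) h.2⟩

theorem nonneg (h : CardLE s A) : 0 ≤ A := (Nat.cast_nonneg _).trans h.2

theorem of_injOn {u : Set β} (f : α → β) (hu : CardLE u A) (hf : Set.MapsTo f s u)
    (hi : Set.InjOn f s) : CardLE s A :=
  ⟨hu.1.of_injOn hf hi,
    le_trans (by exact_mod_cast Set.ncard_le_ncard_of_injOn f hf hi hu.1) hu.2⟩

theorem union (hs : CardLE s A) (ht : CardLE t B) : CardLE (s ∪ t) (A + B) :=
  ⟨hs.1.union ht.1, le_trans (by exact_mod_cast Set.ncard_union_le s t) (add_le_add hs.2 ht.2)⟩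

theorem of_subsingleton (hs : s.Subsingleton) : CardLE s 1 :=
  ⟨hs.finite, by exact_mod_cast Set.ncard_le_one hs.finite |>.2 fun a ha b hb => hs ha hb⟩

theorem of_fibers {u : Set β} (f : α → β) (hu : CardLE u A) (hf : Set.MapsTo f s u) (hB : 0 ≤ B)
    (h : ∀ y ∈ u, CardLE {x ∈ s | f x = y} B) : CardLE s (A * B) := by
  classical
  have hfin : s.Finite := by
    refine (hu.1.biUnion fun y hy => (h y hy).1).subset fun x hx => ?_
    exact Set.mem_biUnion (hf hx) ⟨hx, rfl⟩
  refine ⟨hfin, ?_⟩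
  have hmaps : ∀ x ∈ hfin.toFinset, f x ∈ hu.1.toFinset := fun x hx => by
    simpa using hf (by simpa using hx)
  rw [Set.ncard_eq_toFinset_card s hfin, Finset.card_eq_sum_card_fiberwise hmaps, Nat.cast_sum]
  have hle : ∀ y ∈ hu.1.toFinset,
      (((hfin.toFinset.filter fun x => f x = y).card : ℕ) : ℝ) ≤ B := fun y hy => by
    have hy' : y ∈ u := by simpa using hy
    refine le_trans (le_of_eq ?_) (h y hy').2
    rw [← Set.ncard_coe_finset]
    congr 2
    ext x
    simp
  refine (Finset.sum_le_card_nsmul _ _ _ hle).trans ?_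
  rw [nsmul_eq_mul, ← Set.ncard_eq_toFinset_card u hu.1]
  exact mul_le_mul_of_nonneg_right hu.2 hB

theorem of_finset (s : Finset α) : CardLE (s : Set α) s.card :=
  ⟨s.finite_toSet, by rw [Set.ncard_coe_finset]⟩

end CardLE

/-! ### Coordinate maps. -/

/-- Deleting the first coordinate. -/
def tailHom (N : ℕ) : (Fin (N + 1) → ℤ) →ₙ+* (Fin N → ℤ) where
  toFun x := Fin.tail x
  map_mul' _ _ := rfl
  map_zero' := rfl
  map_add' _ _ := rfl

/-- Extending a vector by a first coordinate `0`. -/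
def consZeroHom (N : ℕ) : (Fin N → ℤ) →ₙ+* (Fin (N + 1) → ℤ) where
  toFun x := Fin.cons 0 x
  map_mul' x y := by ext i; refine Fin.cases ?_ (fun i => ?_) i <;> simp
  map_zero' := by ext i; refine Fin.cases ?_ (fun i => ?_) i <;> simp
  map_add' x y := by ext i; refine Fin.cases ?_ (fun i => ?_) i <;> simp

/-! ### Divisibility and quadratic equations modulo prime powers. -/

section ZModPrimePow

variable {p b : ℕ}

theorem ZMod.primePow_dvd_intCast_iff {c : ℕ} (hc : c ≤ b) (x : ℤ) :
    (p : ZMod (p ^ b)) ^ c ∣ (x : ZMod (p ^ b)) ↔ (p : ℤ) ^ c ∣ x := by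
  constructor
  · rintro ⟨w, hw⟩
    obtain ⟨w, rfl⟩ := ZMod.intCast_surjective w
    have h : ((x - p ^ c * w : ℤ) : ZMod (p ^ b)) = 0 := by push_cast; rw [hw]; ring
    rw [ZMod.intCast_zmod_eq_zero_iff_dvd] at h
    push_cast at h
    have h2 := (pow_dvd_pow (p : ℤ) hc).trans h
    exact (dvd_sub_left (dvd_mul_right _ _)).1 h2
  · rintro ⟨w, rfl⟩
    exact ⟨w, by push_cast; ring⟩

variable [hp : Fact p.Prime]

/-- If both failed, the valuations would add up to at most `(c - 1) + (d - 1) < b`. -/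
theorem pow_dvd_or_pow_dvd_of_pow_dvd_mul {x y : ℤ} {c d : ℕ} (h : (p : ℤ) ^ b ∣ x * y)
    (hcd : c + d ≤ b + 1) : (p : ℤ) ^ c ∣ x ∨ (p : ℤ) ^ d ∣ y := by
  have hpi : Prime (p : ℤ) := Nat.prime_iff_prime_int.1 hp.out
  induction c generalizing x d b with
  | zero => simp
  | succ c ih =>
    by_cases hx : (p : ℤ) ∣ x
    · obtain ⟨x', rfl⟩ := hx
      cases b with
      | zero =>
        have : d = 0 := by omega
        simp [this]
      | succ b =>
        have h' : (p : ℤ) ^ b ∣ x' * y := by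
          rw [pow_succ', mul_assoc] at h
          exact (mul_dvd_mul_iff_left hpi.ne_zero).1 h
        rcases ih h' (d := d) (by omega) with h1 | h1
        · left
          rw [pow_succ']
          exact mul_dvd_mul_left _ h1
        · exact Or.inr h1
    · right
      have : (p : ℤ) ^ b ∣ y := hpi.pow_dvd_of_dvd_mul_left b hx h
      exact (pow_dvd_pow _ (by omega)).trans this

theorem ZMod.primePow_dvd_or_of_mul_eq_zero {x y : ZMod (p ^ b)} {c d : ℕ} (h : x * y = 0)
    (hc : c ≤ b) (hd : d ≤ b) (hcd : c + d ≤ b + 1) :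
    (p : ZMod (p ^ b)) ^ c ∣ x ∨ (p : ZMod (p ^ b)) ^ d ∣ y := by
  obtain ⟨x, rfl⟩ := ZMod.intCast_surjective x
  obtain ⟨y, rfl⟩ := ZMod.intCast_surjective y
  rw [ZMod.primePow_dvd_intCast_iff hc, ZMod.primePow_dvd_intCast_iff hd]
  rw [← Int.cast_mul, ZMod.intCast_zmod_eq_zero_iff_dvd] at h
  push_cast at h
  exact pow_dvd_or_pow_dvd_of_pow_dvd_mul h hcd

theorem ZMod.primePow_dvd_of_pow_mul_eq_zero {x : ZMod (p ^ b)} {a : ℕ}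
    (h : (p : ZMod (p ^ b)) ^ a * x = 0) : (p : ZMod (p ^ b)) ^ (b - a) ∣ x := by
  by_cases hab : a ≤ b
  · obtain ⟨x, rfl⟩ := ZMod.intCast_surjective x
    rw [ZMod.primePow_dvd_intCast_iff (by omega)]
    have h' : ((p ^ a * x : ℤ) : ZMod (p ^ b)) = 0 := by push_cast; exact h
    rw [ZMod.intCast_zmod_eq_zero_iff_dvd] at h'
    push_cast at h'
    have hpi : Prime (p : ℤ) := Nat.prime_iff_prime_int.1 hp.out
    rw [← Nat.add_sub_cancel' hab, pow_add] at h'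
    simpa using (mul_dvd_mul_iff_left (pow_ne_zero a hpi.ne_zero)).1 h'
  · have : b - a = 0 := by omega
    simp [this]

theorem ZMod.cardLE_primePow_dvd_sub {c : ℕ} (hc : c ≤ b) (y : ZMod (p ^ b)) :
    CardLE {z : ZMod (p ^ b) | (p : ZMod (p ^ b)) ^ c ∣ z - y} ((p : ℝ) ^ (b - c)) := by
  classical
  have hpos : 0 < p := hp.out.pos
  refine (CardLE.mono (CardLE.of_finset ((Finset.range (p ^ (b - c))).image
    fun w : ℕ => y + (p : ZMod (p ^ b)) ^ c * (w : ZMod (p ^ b)))) ?_).subset ?_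
  · refine (Nat.cast_le.2 Finset.card_image_le).trans ?_
    simp
  · rintro z ⟨w, hw⟩
    have : NeZero (p ^ b) := ⟨(pow_pos hpos b).ne'⟩
    simp only [Finset.coe_image, Finset.coe_range, Set.mem_image, Set.mem_Iio]
    refine ⟨w.val % p ^ (b - c), Nat.mod_lt _ (pow_pos hpos _), ?_⟩
    have h1 : z = y + (p : ZMod (p ^ b)) ^ c * ((w.val : ℕ) : ZMod (p ^ b)) := by
      rw [ZMod.natCast_zmod_val, ← hw]; ring
    have h0 : (p : ZMod (p ^ b)) ^ c * (p : ZMod (p ^ b)) ^ (b - c) = 0 := by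
      rw [← pow_add, Nat.add_sub_cancel' hc, ← Nat.cast_pow, ZMod.natCast_self]
    rw [h1]
    conv_rhs => rw [← Nat.mod_add_div w.val (p ^ (b - c))]
    push_cast
    rw [mul_add, ← mul_assoc ((p : ZMod (p ^ b)) ^ c), h0]
    ring

/-- A monic quadratic equation has at most `2 p ^ ⌊b / 2⌋` solutions modulo `p ^ b`. -/
theorem ZMod.cardLE_quadratic (c d : ZMod (p ^ b)) :
    CardLE {y : ZMod (p ^ b) | y * y = c * y + d} (2 * (p : ℝ) ^ (b / 2)) := by
  rcases Set.eq_empty_or_nonempty {y : ZMod (p ^ b) | y * y = c * y + d} with h | ⟨y₀, hy₀⟩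
  · rw [h]
    exact ⟨Set.finite_empty, by simp⟩
  · have hb : b - (b - b / 2) = b / 2 := by omega
    have h1 := ZMod.cardLE_primePow_dvd_sub (p := p) (c := b - b / 2) (Nat.sub_le b (b / 2)) y₀
    have h2 := ZMod.cardLE_primePow_dvd_sub (p := p) (c := b - b / 2) (Nat.sub_le b (b / 2)) (c - y₀)
    rw [hb] at h1 h2
    refine ((h1.union h2).mono (by linarith)).subset fun y hy => ?_
    -- By Vieta the other root is `c - y₀`. Since `2 ⌈b / 2⌉ ≤ b + 1`, any root agrees with one of
    -- these two modulo `p ^ ⌈b / 2⌉`.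
    have h0 : (y - y₀) * (y - (c - y₀)) = 0 := by
      simp only [Set.mem_ofPred_eq] at hy hy₀
      linear_combination hy - hy₀
    exact ZMod.primePow_dvd_or_of_mul_eq_zero h0 (by omega) (by omega) (by omega)

end ZModPrimePow

/-! ### Counting ring homomorphisms to `ℤ / p ^ b`. -/

section Homs

variable {N : ℕ}

theorem exists_hom_map_tail {A : Type*} [NonUnitalCommRing A]
    (S : NonUnitalSubring (Fin (N + 1) → ℤ)) (Φ : S →ₙ+* A)
    (h : ∀ u : S, tailHom N u = 0 → Φ u = 0) :
    ∃ ψ : S.map (tailHom N) →ₙ+* A,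
      ∀ u : S, ψ ⟨tailHom N u, NonUnitalSubring.mem_map.2 ⟨u, u.2, rfl⟩⟩ = Φ u := by
  have hex : ∀ w : S.map (tailHom N), ∃ u : S, tailHom N u = w := fun w => by
    obtain ⟨u, hu, huw⟩ := NonUnitalSubring.mem_map.1 w.2
    exact ⟨⟨u, hu⟩, huw⟩
  choose g hg using hex
  have key : ∀ u v : S, tailHom N u = tailHom N v → Φ u = Φ v := fun u v huv => by
    rw [← sub_eq_zero, ← map_sub]
    exact h _ ((map_sub (tailHom N) _ _).trans (by rw [huv, sub_self]))
  refine ⟨{ toFun := fun w => Φ (g w), map_mul' := ?_, map_zero' := ?_, map_add' := ?_ }, ?_⟩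
  · intro w w'
    rw [← map_mul]
    exact key _ _ ((hg _).trans ((map_mul (tailHom N) _ _).trans (by rw [hg, hg]; rfl)).symm)
  · exact h _ (hg 0)
  · intro w w'
    rw [← map_add]
    exact key _ _ ((hg _).trans ((map_add (tailHom N) _ _).trans (by rw [hg, hg]; rfl)).symm)
  · intro u
    exact key _ _ (hg _)

/-- The inclusion into `S` of its elements with first coordinate `0`. -/
def headKernelHom (S : NonUnitalSubring (Fin (N + 1) → ℤ)) : S.comap (consZeroHom N) →ₙ+* S where
  toFun u := ⟨consZeroHom N u, u.2⟩
  map_mul' u v := Subtype.ext (map_mul (consZeroHom N) (u : Fin N → ℤ) v)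
  map_zero' := Subtype.ext (map_zero (consZeroHom N))
  map_add' u v := Subtype.ext (map_add (consZeroHom N) (u : Fin N → ℤ) v)

theorem exists_headKernelHom_eq (S : NonUnitalSubring (Fin (N + 1) → ℤ)) (u : S)
    (hu : (u : Fin (N + 1) → ℤ) 0 = 0) : ∃ w, headKernelHom S w = u := by
  have h : consZeroHom N (Fin.tail (u : Fin (N + 1) → ℤ)) = u := by
    change Fin.cons 0 (Fin.tail (u : Fin (N + 1) → ℤ)) = (u : Fin (N + 1) → ℤ)
    rw [← hu, Fin.cons_self_tail]
  refine ⟨⟨Fin.tail (u : Fin (N + 1) → ℤ), ?_⟩, Subtype.ext h⟩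
  rw [NonUnitalSubring.mem_comap, h]
  exact u.2

/-- A generator of `S` modulo its elements with first coordinate `0`. -/
theorem exists_head_generator (S : NonUnitalSubring (Fin (N + 1) → ℤ)) :
    ∃ v : S, (∀ u : S, ∃ (t : ℤ) (w : S.comap (consZeroHom N)), u = t • v + headKernelHom S w) ∧
      ∃ (c : ℤ) (w : S.comap (consZeroHom N)), v * v = c • v + headKernelHom S w := by
  let H : AddSubgroup ℤ := S.toAddSubgroup.map (Pi.evalAddMonoidHom (fun _ => ℤ) 0)
  obtain ⟨d, hd⟩ := Int.subgroup_cyclic H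
  have hdH : d ∈ H := by rw [hd]; exact AddSubgroup.mem_closure_singleton_self d
  obtain ⟨v, hv, hvd⟩ := hdH
  have hvd' : v 0 = d := hvd
  have hgen : ∀ u : S, ∃ (t : ℤ) (w : S.comap (consZeroHom N)),
      u = t • (⟨v, hv⟩ : S) + headKernelHom S w := by
    intro u
    have hu : (u : Fin (N + 1) → ℤ) 0 ∈ H := ⟨u, u.2, rfl⟩
    rw [hd, AddSubgroup.mem_closure_singleton] at hu
    obtain ⟨t, ht⟩ := hu
    obtain ⟨w, hw⟩ := exists_headKernelHom_eq S (u - t • (⟨v, hv⟩ : S)) (by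
      change (u : Fin (N + 1) → ℤ) 0 - t • v 0 = 0
      rw [hvd', ht, sub_self])
    exact ⟨t, w, by rw [hw]; abel⟩
  exact ⟨⟨v, hv⟩, hgen, hgen _⟩

theorem hom_ext_of_head_generator {A : Type*} [NonUnitalCommRing A]
    {S : NonUnitalSubring (Fin (N + 1) → ℤ)} {v : S}
    (hv : ∀ u : S, ∃ (t : ℤ) (w : S.comap (consZeroHom N)), u = t • v + headKernelHom S w)
    {φ ψ : S →ₙ+* A} (h : φ.comp (headKernelHom S) = ψ.comp (headKernelHom S))
    (h' : φ v = ψ v) : φ = ψ := by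
  ext u
  obtain ⟨t, w, rfl⟩ := hv u
  have := DFunLike.congr_fun h w
  simp only [NonUnitalRingHom.comp_apply] at this
  rw [map_add, map_add, map_zsmul, map_zsmul, h', this]

theorem subsingleton_hom_of_zero {A : Type*} [NonUnitalCommRing A]
    (S : NonUnitalSubring (Fin 0 → ℤ)) (s : Set (S →ₙ+* A)) : s.Subsingleton := by
  intro φ _ ψ _
  ext u
  have : u = 0 := Subtype.ext (Subsingleton.elim _ _)
  rw [this, map_zero, map_zero]

variable {p : ℕ} [hp : Fact p.Prime] {b : ℕ}

/-- Once `φ` is fixed on the elements with first coordinate `0`, it is determined by `φ v`, and the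
relation `v * v = c • v + w` makes `φ v` a root of a fixed monic quadratic. -/
theorem cardLE_hom (S : NonUnitalSubring (Fin N → ℤ)) :
    CardLE (Set.univ : Set (S →ₙ+* ZMod (p ^ b))) ((2 * (p : ℝ) ^ (b / 2)) ^ N) := by
  induction N with
  | zero => simpa using CardLE.of_subsingleton (subsingleton_hom_of_zero S _)
  | succ N ih =>
    obtain ⟨v, hgen, c, w, hw⟩ := exists_head_generator S
    rw [pow_succ]
    refine CardLE.of_fibers (fun φ => φ.comp (headKernelHom S)) (ih _) (fun _ _ => Set.mem_univ _)
      (by positivity) fun ψ _ => ?_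
    refine CardLE.of_injOn (fun φ => φ v)
      (ZMod.cardLE_quadratic (p := p) (b := b) (c : ZMod (p ^ b)) (ψ w)) ?_ ?_
    · rintro φ ⟨-, rfl⟩
      change φ v * φ v = c * φ v + φ (headKernelHom S w)
      rw [← map_mul, hw, map_add, map_zsmul, zsmul_eq_mul]
    · rintro φ ⟨-, hφ⟩ φ' ⟨-, hφ'⟩ h
      exact hom_ext_of_head_generator hgen (hφ.trans hφ'.symm) h

/-- Each of the `N` successive generators has its image prescribed modulo `p ^ c`, leaving `p ^ (b -
c)` choices. No multiplicative relation is needed. -/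
theorem cardLE_hom_near (S : NonUnitalSubring (Fin N → ℤ)) {c : ℕ} (hc : c ≤ b)
    (f : S → ZMod (p ^ b)) :
    CardLE {φ : S →ₙ+* ZMod (p ^ b) | ∀ u, (p : ZMod (p ^ b)) ^ c ∣ φ u - f u}
      (((p : ℝ) ^ (b - c)) ^ N) := by
  induction N with
  | zero => simpa using CardLE.of_subsingleton (subsingleton_hom_of_zero S _)
  | succ N ih =>
    obtain ⟨v, hgen, -⟩ := exists_head_generator S
    rw [pow_succ]
    refine CardLE.of_fibers (fun φ => φ.comp (headKernelHom S)) (ih _ (f ∘ headKernelHom S))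
      (fun φ hφ u => hφ _) (by positivity) fun ψ _ => ?_
    refine CardLE.of_injOn (fun φ => φ v) (ZMod.cardLE_primePow_dvd_sub hc (f v))
      (fun φ hφ => hφ.1 v) ?_
    rintro φ ⟨-, hφ⟩ φ' ⟨-, hφ'⟩ h
    exact hom_ext_of_head_generator hgen (hφ.trans hφ'.symm) h

/-- `HasDiagonal p N a S`: the triangular basis of `S` has diagonal entries `p ^ a i`. -/
def HasDiagonal (p : ℕ) : (N : ℕ) → (Fin N → ℕ) → NonUnitalSubring (Fin N → ℤ) → Prop
  | 0, _, _ => True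
  | N + 1, a, S => (∀ t : ℤ, Pi.single 0 t ∈ S ↔ (p : ℤ) ^ a 0 ∣ t) ∧
      HasDiagonal p N (Fin.tail a) (S.map (tailHom N))

theorem single_of_tailHom_eq_zero {u : Fin (N + 1) → ℤ} (h : tailHom N u = 0) :
    u = Pi.single 0 (u 0) := by
  ext i
  refine Fin.cases ?_ (fun i => ?_) i
  · simp
  · rw [Pi.single_eq_of_ne (Fin.succ_ne_zero i)]
    exact congrFun h i

/-- The vector `e = p ^ a 0` on the first axis satisfies `e * e = p ^ a 0 • e`, so `φ e` is close to
`0` or to `p ^ a 0`. In the first case `φ` descends, modulo `p ^ (b - a 0)`, to the projection of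
`S`; in the second it is close to the first coordinate function. Either way the loss of `a 0` digits
costs at most `p ^ ((N + 1) * a 0)`. -/
theorem cardLE_hom_of_hasDiagonal {a : Fin N → ℕ} {S : NonUnitalSubring (Fin N → ℤ)}
    (hS : HasDiagonal p N a S) :
    CardLE (Set.univ : Set (S →ₙ+* ZMod (p ^ b))) (2 ^ N * (p : ℝ) ^ (N * ∑ i, a i)) := by
  induction N generalizing b with
  | zero => simpa using CardLE.of_subsingleton (subsingleton_hom_of_zero S _)
  | succ N ih =>
    have hp1 : (1 : ℝ) ≤ p := by exact_mod_cast hp.out.one_le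
    obtain ⟨h0, hS'⟩ := hS
    -- Truncated subtraction: when `b ≤ a 0` this is `0`, and the first case below holds trivially.
    set c := b - a 0 with hc
    have hcb : c ≤ b := Nat.sub_le _ _
    have hca : b - c ≤ a 0 := by omega
    let e : S := ⟨Pi.single 0 ((p : ℤ) ^ a 0), (h0 _).2 dvd_rfl⟩
    have he : ∀ u : S, u * e = ((u : Fin (N + 1) → ℤ) 0) • e := fun u => by
      apply Subtype.ext
      ext i
      refine Fin.cases ?_ (fun i => ?_) i <;> simp [e]
    have hee : e * e = ((p : ℤ) ^ a 0) • e := by simpa [e] using he e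
    let q : ZMod (p ^ b) →ₙ+* ZMod (p ^ c) :=
      (ZMod.castHom (pow_dvd_pow p hcb) (ZMod (p ^ c)) : ZMod (p ^ b) →+* ZMod (p ^ c))
    have hq : ∀ z, q z = 0 ↔ (p : ZMod (p ^ b)) ^ c ∣ z := fun z => by
      obtain ⟨z, rfl⟩ := ZMod.intCast_surjective z
      have : q (z : ZMod (p ^ b)) = (z : ZMod (p ^ c)) :=
        map_intCast (ZMod.castHom (pow_dvd_pow p hcb) (ZMod (p ^ c))) z
      rw [this, ZMod.primePow_dvd_intCast_iff hcb, ZMod.intCast_zmod_eq_zero_iff_dvd]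
      push_cast
      rfl
    have near : ∀ f : S → ZMod (p ^ b), CardLE {φ : S →ₙ+* ZMod (p ^ b) |
        ∀ u, (p : ZMod (p ^ b)) ^ c ∣ φ u - f u} (((p : ℝ) ^ a 0) ^ (N + 1)) := fun f =>
      (cardLE_hom_near S hcb f).mono (by gcongr)
    have case1 : CardLE {φ : S →ₙ+* ZMod (p ^ b) | (p : ZMod (p ^ b)) ^ c ∣ φ e}
        (2 ^ N * (p : ℝ) ^ (N * ∑ i, Fin.tail a i) * ((p : ℝ) ^ a 0) ^ (N + 1)) := by
      have hdesc : ∀ φ : S →ₙ+* ZMod (p ^ b), ∃ ψ : S.map (tailHom N) →ₙ+* ZMod (p ^ c),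
          (p : ZMod (p ^ b)) ^ c ∣ φ e → ∀ u : S,
            ψ ⟨tailHom N u, NonUnitalSubring.mem_map.2 ⟨u, u.2, rfl⟩⟩ = q (φ u) := by
        intro φ
        by_cases hφ : (p : ZMod (p ^ b)) ^ c ∣ φ e
        · obtain ⟨ψ, hψ⟩ := exists_hom_map_tail S (q.comp φ) (fun u hu => by
            have hu' := single_of_tailHom_eq_zero hu
            have hmem := u.2
            rw [hu', h0] at hmem
            obtain ⟨t, ht⟩ := hmem
            have : u = t • e := by
              apply Subtype.ext
              rw [hu', ht]
              ext i
              refine Fin.cases ?_ (fun i => ?_) i <;> simp [e, mul_comm]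
            rw [this, map_zsmul, NonUnitalRingHom.comp_apply, (hq _).2 hφ, smul_zero])
          exact ⟨ψ, fun _ => hψ⟩
        -- Junk value, used only to make `D` total.
        · exact ⟨0, fun h => absurd h hφ⟩
      choose D hD using hdesc
      refine CardLE.of_fibers D (ih hS') (fun _ _ => Set.mem_univ _) (by positivity) fun ψ _ => ?_
      rcases Set.eq_empty_or_nonempty
        {φ ∈ {φ : S →ₙ+* ZMod (p ^ b) | (p : ZMod (p ^ b)) ^ c ∣ φ e} | D φ = ψ} with h | ⟨φ₀, h₀, h₀'⟩
      · rw [h]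
        exact ⟨Set.finite_empty, by rw [Set.ncard_empty, Nat.cast_zero]; positivity⟩
      · refine (near φ₀).subset ?_
        rintro φ ⟨h₁, h₁'⟩ u
        rw [← hq, map_sub, ← hD φ h₁, ← hD φ₀ h₀, h₀', h₁', sub_self]
    have case2 : CardLE {φ : S →ₙ+* ZMod (p ^ b) |
        (p : ZMod (p ^ b)) ^ (a 0 + 1) ∣ φ e - (p : ZMod (p ^ b)) ^ a 0}
        (((p : ℝ) ^ a 0) ^ (N + 1)) := by
      refine (near fun u => ((u : Fin (N + 1) → ℤ) 0 : ZMod (p ^ b))).subset ?_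
      rintro φ ⟨t, ht⟩ u
      have h1 : (φ u - ((u : Fin (N + 1) → ℤ) 0 : ZMod (p ^ b))) * φ e = 0 := by
        rw [sub_mul, ← map_mul, he, map_zsmul, zsmul_eq_mul, sub_self]
      have h2 : φ e = (p : ZMod (p ^ b)) ^ a 0 * (1 + p * t) := by linear_combination ht
      -- Here `φ e` is `p ^ a 0` times a unit, so the relation `(φ u - u 0) * φ e = 0` forces `φ u`
      -- and `u 0` to agree modulo `p ^ (b - a 0)`.
      have hunit : IsUnit (1 + (p : ZMod (p ^ b)) * t) := by
        have hnil : IsNilpotent ((p : ZMod (p ^ b)) * t) :=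
          ⟨b, by rw [mul_pow, ← Nat.cast_pow, ZMod.natCast_self, zero_mul]⟩
        exact hnil.isUnit_one_add
      refine ZMod.primePow_dvd_of_pow_mul_eq_zero (p := p) (b := b) (a := a 0) ?_
      rw [← hunit.mul_left_inj, zero_mul, ← h1, h2]
      ring
    refine ((case1.union case2).subset fun φ _ => ?_).mono ?_
    · by_cases hab : b ≤ a 0
      · left
        have : c = 0 := by omega
        simp [this]
      · have h1 : φ e * (φ e - (p : ZMod (p ^ b)) ^ a 0) = 0 := by
          rw [mul_sub, ← map_mul, hee, map_zsmul, zsmul_eq_mul]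
          push_cast
          ring
        -- The exponents `b - a 0` and `a 0 + 1` sum to exactly `b + 1`, the most the dichotomy
        -- allows.
        exact ZMod.primePow_dvd_or_of_mul_eq_zero h1 hcb (by omega) (by omega)
    · rw [Fin.sum_univ_succ, mul_add, pow_add _ ((N + 1) * a 0), ← pow_mul,
        mul_comm (a 0) (N + 1)]
      have h1 : (p : ℝ) ^ (N * ∑ i, Fin.tail a i) ≤ (p : ℝ) ^ ((N + 1) * ∑ i : Fin N, a i.succ) :=
        pow_le_pow_right₀ hp1 (Nat.mul_le_mul_right _ (Nat.le_succ N))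
      have h2 : (1 : ℝ) ≤ 2 ^ N * (p : ℝ) ^ ((N + 1) * ∑ i : Fin N, a i.succ) := by
        have := one_le_pow₀ (n := N) (one_le_two : (1 : ℝ) ≤ 2)
        exact one_le_mul_of_one_le_of_one_le this (one_le_pow₀ hp1)
      have h3 : (0 : ℝ) ≤ (p : ℝ) ^ ((N + 1) * a 0) := by positivity
      calc 2 ^ N * (p : ℝ) ^ (N * ∑ i, Fin.tail a i) * (p : ℝ) ^ ((N + 1) * a 0)
            + (p : ℝ) ^ ((N + 1) * a 0)
          = (2 ^ N * (p : ℝ) ^ (N * ∑ i, Fin.tail a i) + 1) * (p : ℝ) ^ ((N + 1) * a 0) := by ring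
        _ ≤ (2 ^ N * (p : ℝ) ^ ((N + 1) * ∑ i : Fin N, a i.succ) +
              2 ^ N * (p : ℝ) ^ ((N + 1) * ∑ i : Fin N, a i.succ)) * (p : ℝ) ^ ((N + 1) * a 0) := by
            gcongr
        _ = _ := by ring

end Homs

/-! ### Counting sublattices with a given diagonal. -/

section Diagonal

variable {N p : ℕ}

/-- The index is that of the part of `S` on the first axis times that of the projection, so both are
powers of `p`. An exponent `0` would put a vector with an entry `1` into `S` or a projection of it,
contrary to divisibility by `p`. -/
theorem hasDiagonal_exists [hp : Fact p.Prime] {S : NonUnitalSubring (Fin N → ℤ)} {e : ℕ}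
    (hS : S.toAddSubgroup.index = p ^ e) (hpS : ∀ x ∈ S, ∀ i, (p : ℤ) ∣ x i) :
    ∃ a : Fin N → ℕ, HasDiagonal p N a S ∧ ∑ i, a i = e ∧ ∀ i, 1 ≤ a i := by
  induction N generalizing e with
  | zero =>
    refine ⟨0, trivial, ?_, fun i => i.elim0⟩
    have : S.toAddSubgroup = ⊤ := by
      ext x
      rw [Subsingleton.elim x 0]
      exact iff_of_true (zero_mem _) (zero_mem _)
    rw [this, AddSubgroup.index_top] at hS
    have := (Nat.pow_eq_one.1 hS.symm).resolve_left hp.out.one_lt.ne'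
    simp [this]
  | succ N ih =>
    let H := S.toAddSubgroup
    let f : (Fin (N + 1) → ℤ) →+ (Fin N → ℤ) := (tailHom N : (Fin (N + 1) → ℤ) →+ (Fin N → ℤ))
    let g : ℤ →+ (Fin (N + 1) → ℤ) := AddMonoidHom.single (fun _ => ℤ) 0
    have hf : Function.Surjective f := fun y =>
      ⟨Fin.cons 0 y, Fin.tail_cons (α := fun _ => ℤ) 0 y⟩
    have hker : f.ker = g.range := by
      ext u
      constructor
      · intro hu
        exact ⟨u 0, (single_of_tailHom_eq_zero hu).symm⟩
      · rintro ⟨t, rfl⟩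
        ext i
        change (Pi.single 0 t : Fin (N + 1) → ℤ) i.succ = 0
        simp
    have hidx : (H.comap g).index * (H.map f).index = p ^ e := by
      rw [AddSubgroup.index_map, AddMonoidHom.range_eq_top.2 hf, AddSubgroup.index_top, mul_one,
        AddSubgroup.index_comap, ← hker, ← AddSubgroup.relIndex_sup_right,
        sup_comm, AddSubgroup.relIndex_mul_index le_sup_left]
      exact hS
    obtain ⟨c, -, hc⟩ := (Nat.dvd_prime_pow hp.out).1 ⟨_, hidx.symm⟩
    obtain ⟨c', -, hc'⟩ := (Nat.dvd_prime_pow hp.out).1 (Dvd.intro_left _ hidx)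
    obtain ⟨a, ha, hsum, hpos⟩ := ih (S := S.map (tailHom N)) (e := c') hc' (by
      rintro x ⟨u, hu, rfl⟩ i
      exact hpS u hu i.succ)
    have hmem : ∀ t : ℤ, Pi.single 0 t ∈ S ↔ (p : ℤ) ^ c ∣ t := by
      obtain ⟨d, hd⟩ := Int.subgroup_cyclic (H.comap g)
      rw [← AddSubgroup.zmultiples_eq_closure] at hd
      rw [hd, Int.index_zmultiples] at hc
      intro t
      have : Pi.single 0 t ∈ S ↔ t ∈ H.comap g := Iff.rfl
      rw [this, hd, Int.mem_zmultiples_iff, ← Int.natAbs_dvd, hc]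
      push_cast
      rfl
    refine ⟨Fin.cons c a, ⟨by simpa using hmem, by simpa using ha⟩, ?_, ?_⟩
    · rw [hc, hc', ← pow_add] at hidx
      rw [Fin.sum_cons, hsum]
      exact Nat.pow_right_injective hp.out.two_le hidx
    · refine Fin.cases ?_ hpos
      rw [Fin.cons_zero]
      by_contra h
      have h0 : c = 0 := by omega
      have h1 := hpS _ ((hmem 1).2 (by simp [h0])) 0
      rw [Pi.single_eq_same] at h1
      exact hp.out.one_lt.ne' (by exact_mod_cast Int.eq_one_of_dvd_one (by positivity) h1)

/-- The first coordinate, modulo `p ^ a 0`, is a well-defined ring homomorphism `ψ` on the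
projection `S'`, and `S` is recovered as the set of `u` with tail in `S'` and `u 0 ≡ ψ (tail u)`. -/
theorem cardLE_hasDiagonal_succ {a : Fin (N + 1) → ℕ} {A B : ℝ}
    (hA : CardLE {S | HasDiagonal p N (Fin.tail a) S} A) (hB0 : 0 ≤ B)
    (hB : ∀ S : NonUnitalSubring (Fin N → ℤ), HasDiagonal p N (Fin.tail a) S →
      CardLE (Set.univ : Set (S →ₙ+* ZMod (p ^ a 0))) B) :
    CardLE {S | HasDiagonal p (N + 1) a S} (A * B) := by
  refine CardLE.of_fibers (fun S => S.map (tailHom N)) hA (fun S hS => hS.2) hB0 fun S' hS' => ?_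
  have hex : ∀ S : NonUnitalSubring (Fin (N + 1) → ℤ), ∃ ψ : S' →ₙ+* ZMod (p ^ a 0),
      HasDiagonal p (N + 1) a S → S.map (tailHom N) = S' →
      ∀ u ∈ S, ∀ h : tailHom N u ∈ S', ψ ⟨tailHom N u, h⟩ = (u 0 : ZMod (p ^ a 0)) := by
    intro S
    by_cases hS : HasDiagonal p (N + 1) a S ∧ S.map (tailHom N) = S'
    · obtain ⟨hS, rfl⟩ := hS
      obtain ⟨ψ, hψ⟩ := exists_hom_map_tail S
        ({ toFun := fun u => (((u : Fin (N + 1) → ℤ) 0 : ℤ) : ZMod (p ^ a 0))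
           map_mul' := fun u v => Int.cast_mul _ _
           map_zero' := Int.cast_zero
           map_add' := fun u v => Int.cast_add _ _ } : S →ₙ+* ZMod (p ^ a 0)) (fun u hu => by
          have hmem := u.2
          rw [single_of_tailHom_eq_zero hu, hS.1] at hmem
          change (((u : Fin (N + 1) → ℤ) 0 : ℤ) : ZMod (p ^ a 0)) = 0
          rw [ZMod.intCast_zmod_eq_zero_iff_dvd]
          exact_mod_cast hmem)
      exact ⟨ψ, fun _ _ u hu _ => hψ ⟨u, hu⟩⟩
    · exact ⟨0, fun h h' => absurd ⟨h, h'⟩ hS⟩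
  choose ψ hψ using hex
  refine CardLE.of_injOn ψ (hB S' hS') (fun _ _ => Set.mem_univ _) ?_
  have key : ∀ S T : NonUnitalSubring (Fin (N + 1) → ℤ), HasDiagonal p (N + 1) a S →
      S.map (tailHom N) = S' → HasDiagonal p (N + 1) a T → T.map (tailHom N) = S' →
      ψ S = ψ T → S ≤ T := by
    intro S T hS hS₁ hT hT₁ h u hu
    have hu' : tailHom N u ∈ S' := hS₁ ▸ NonUnitalSubring.mem_map.2 ⟨u, hu, rfl⟩
    obtain ⟨v, hv, hvu⟩ := NonUnitalSubring.mem_map.1 (hT₁.symm ▸ hu')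
    have hv' : tailHom N v ∈ S' := hvu ▸ hu'
    have h1 := hψ S hS hS₁ u hu hu'
    have h2 := hψ T hT hT₁ v hv hv'
    have h3 : ((u 0 : ℤ) : ZMod (p ^ a 0)) = (v 0 : ℤ) := by
      rw [← h1, ← h2, h]
      congr 1
      exact Subtype.ext hvu.symm
    have h4 : u - v = Pi.single 0 ((u - v) 0) :=
      single_of_tailHom_eq_zero (by rw [map_sub, hvu, sub_self])
    have h5 : u - v ∈ T := by
      rw [h4, hT.1]
      have h6 := (ZMod.intCast_eq_intCast_iff_dvd_sub _ _ _).1 h3.symm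
      exact_mod_cast h6
    simpa using T.add_mem h5 hv
  rintro S ⟨hS, hS₁⟩ T ⟨hT, hT₁⟩ h
  exact le_antisymm (key S T hS hS₁ hT hT₁ h) (key T S hT hT₁ hS hS₁ h.symm)

theorem pow_half_mul_le_rpow (hp1 : (1 : ℝ) ≤ p) (N b : ℕ) :
    (2 * (p : ℝ) ^ (b / 2)) ^ N ≤ 2 ^ N * (p : ℝ) ^ ((N : ℝ) * b / 2) := by
  rw [mul_pow, ← pow_mul, ← Real.rpow_natCast (p : ℝ)]
  gcongr
  · push_cast
    have : ((b / 2 : ℕ) : ℝ) ≤ (b : ℝ) / 2 := Nat.cast_div_le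
    have hN : (0 : ℝ) ≤ N := N.cast_nonneg
    nlinarith

variable [hp : Fact p.Prime]

/-- Only the quadratic bound is used. The last coordinate contributes nothing to the exponent, which
is where the `- 1` comes from, as its diagonal exponent is at least `1`. -/
theorem cardLE_hasDiagonal (a : Fin (N + 1) → ℕ) (ha : ∀ i, 1 ≤ a i) :
    CardLE {S | HasDiagonal p (N + 1) a S}
      (2 ^ (N + 1) ^ 2 * (p : ℝ) ^ ((N : ℝ) * (∑ i, (a i : ℝ) - 1) / 2)) := by
  have hp1 : (1 : ℝ) ≤ p := by exact_mod_cast hp.out.one_le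
  have hp0 : (0 : ℝ) < p := by linarith
  induction N with
  | zero =>
    have h0 : CardLE {S | HasDiagonal p 0 (Fin.tail a) S} 1 :=
      CardLE.of_subsingleton fun S _ T _ => by
        ext x
        rw [Subsingleton.elim x 0]
        exact iff_of_true (zero_mem _) (zero_mem _)
    refine (cardLE_hasDiagonal_succ h0 zero_le_one fun S _ => ?_).mono ?_
    · simpa using cardLE_hom (p := p) (b := a 0) S
    · simp
  | succ N ih =>
    refine (cardLE_hasDiagonal_succ (ih (Fin.tail a) fun i => ha _) (by positivity)
      fun S _ => (cardLE_hom S).mono (pow_half_mul_le_rpow hp1 _ _)).mono ?_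
    have hsum : (1 : ℝ) ≤ a 0 := by exact_mod_cast ha 0
    have hT : (0 : ℝ) ≤ ∑ i : Fin (N + 1), (a i.succ : ℝ) := by positivity
    have hT1 : (1 : ℝ) ≤ ∑ i : Fin (N + 1), (a i.succ : ℝ) := by
      rw [Fin.sum_univ_succ]
      have h1 : (1 : ℝ) ≤ a (Fin.succ 0) := by exact_mod_cast ha _
      have h2 : (0 : ℝ) ≤ ∑ i : Fin N, (a i.succ.succ : ℝ) := by positivity
      linarith
    rw [Fin.sum_univ_succ (n := N + 1)]
    change 2 ^ (N + 1) ^ 2 * (p : ℝ) ^ ((N : ℝ) * (∑ i : Fin (N + 1), (a i.succ : ℝ) - 1) / 2) *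
      (2 ^ (N + 1) * (p : ℝ) ^ (((N + 1 : ℕ) : ℝ) * a 0 / 2)) ≤ _
    set T := ∑ i : Fin (N + 1), (a i.succ : ℝ)
    have e1 : (2 : ℝ) ^ (N + 1) ^ 2 * 2 ^ (N + 1) ≤ 2 ^ (N + 1 + 1) ^ 2 := by
      rw [← pow_add]
      exact pow_le_pow_right₀ one_le_two (by nlinarith)
    have e2 : (p : ℝ) ^ ((N : ℝ) * (T - 1) / 2) * (p : ℝ) ^ (((N + 1 : ℕ) : ℝ) * a 0 / 2) ≤
        (p : ℝ) ^ (((N + 1 : ℕ) : ℝ) * (a 0 + T - 1) / 2) := by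
      rw [← Real.rpow_add hp0]
      apply Real.rpow_le_rpow_of_exponent_le hp1
      push_cast
      nlinarith
    calc _ = (2 : ℝ) ^ (N + 1) ^ 2 * 2 ^ (N + 1) * ((p : ℝ) ^ ((N : ℝ) * (T - 1) / 2) *
            (p : ℝ) ^ (((N + 1 : ℕ) : ℝ) * a 0 / 2)) := by ring
      _ ≤ _ := by gcongr

/-- The improvement of `cardLE_hasDiagonal` obtained by interpolating the two bounds for the number
of homomorphisms. -/
theorem cardLE_hasDiagonal_interpolated (hN : 3 ≤ N) (a : Fin (N + 1) → ℕ) (ha : ∀ i, 1 ≤ a i) :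
    CardLE {S | HasDiagonal p (N + 1) a S}
      (2 ^ (N + 1) ^ 2 *
        (p : ℝ) ^ ((((N + 1 : ℕ) : ℝ) / 2 - 2 / 3) * ∑ i, (a i : ℝ) - 1)) := by
  obtain ⟨M, rfl⟩ : ∃ M, N = M + 1 := ⟨N - 1, by omega⟩
  have hp1 : (1 : ℝ) ≤ p := by exact_mod_cast hp.out.one_le
  have hp0 : (0 : ℝ) < p := by linarith
  set T := ∑ i : Fin (M + 1), (a i.succ : ℝ) with hT
  -- The surplus `-M / 2` from the tail must pay for the final `- 1`; this is where `3 ≤ N` enters.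
  have hM : (2 : ℝ) ≤ M := by exact_mod_cast (by omega : 2 ≤ M)
  have hB : ∀ S : NonUnitalSubring (Fin (M + 1) → ℤ), HasDiagonal p (M + 1) (Fin.tail a) S →
      CardLE (Set.univ : Set (S →ₙ+* ZMod (p ^ a 0)))
        (2 ^ (M + 1) * (p : ℝ) ^ (((M : ℝ) / 2 + 1 / 3) * a 0 + T / 3)) := by
    intro S hS
    -- The exponents `(M + 1) a 0 / 2` and `(M + 1) T` cross at `a 0 = 2 T`. The linear form in `hB`
    -- passes through the crossing and is chosen so that, after adding `M T / 2` from the tail, `a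
    -- 0` and `T` get the same coefficient.
    rcases le_total ((a 0 : ℝ)) (2 * T) with h | h
    · refine (cardLE_hom S).mono ((pow_half_mul_le_rpow hp1 _ _).trans ?_)
      gcongr
      · push_cast
        nlinarith
    · refine (cardLE_hom_of_hasDiagonal hS).mono ?_
      rw [← Real.rpow_natCast (p : ℝ)]
      gcongr
      · push_cast
        change ((M : ℝ) + 1) * T ≤ _
        nlinarith
  refine (cardLE_hasDiagonal_succ (cardLE_hasDiagonal (Fin.tail a) fun i => ha _) (by positivity)
    hB).mono ?_
  rw [Fin.sum_univ_succ (n := M + 1)]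
  change 2 ^ (M + 1) ^ 2 * (p : ℝ) ^ ((M : ℝ) * (T - 1) / 2) *
    (2 ^ (M + 1) * (p : ℝ) ^ (((M : ℝ) / 2 + 1 / 3) * a 0 + T / 3)) ≤
      2 ^ (M + 1 + 1) ^ 2 * (p : ℝ) ^ ((((M + 1 + 1 : ℕ) : ℝ) / 2 - 2 / 3) * (a 0 + T) - 1)
  have e1 : (2 : ℝ) ^ (M + 1) ^ 2 * 2 ^ (M + 1) ≤ 2 ^ (M + 1 + 1) ^ 2 := by
    rw [← pow_add]
    exact pow_le_pow_right₀ one_le_two (by nlinarith)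
  have e2 : (p : ℝ) ^ ((M : ℝ) * (T - 1) / 2) *
      (p : ℝ) ^ (((M : ℝ) / 2 + 1 / 3) * a 0 + T / 3) ≤
        (p : ℝ) ^ ((((M + 1 + 1 : ℕ) : ℝ) / 2 - 2 / 3) * (a 0 + T) - 1) := by
    rw [← Real.rpow_add hp0]
    apply Real.rpow_le_rpow_of_exponent_le hp1
    push_cast
    nlinarith
  calc _ = (2 : ℝ) ^ (M + 1) ^ 2 * 2 ^ (M + 1) * ((p : ℝ) ^ ((M : ℝ) * (T - 1) / 2) *
          (p : ℝ) ^ (((M : ℝ) / 2 + 1 / 3) * a 0 + T / 3)) := by ring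
    _ ≤ _ := by gcongr

/-- `s` bounds the growth of the number of multiplicative sublattices of `p ℤ ^ j`, `1 ≤ j ≤ k`. -/
def IsLocalExponent (k : ℕ) (s : ℝ) : Prop :=
  ∃ D : ℝ, 0 ≤ D ∧ ∀ p : ℕ, p.Prime → ∀ j ≤ k, 1 ≤ j → ∀ a : Fin j → ℕ, (∀ i, 1 ≤ a i) →
    CardLE {S | HasDiagonal p j a S} (D * (p : ℝ) ^ (s * ∑ i, (a i : ℝ) - 1))

theorem one_le_sum {j : ℕ} (hj : 1 ≤ j) {a : Fin j → ℕ} (ha : ∀ i, 1 ≤ a i) :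
    (1 : ℝ) ≤ ∑ i, (a i : ℝ) := by
  have h := Finset.single_le_sum (f := fun i => (a i : ℝ)) (fun i _ => Nat.cast_nonneg _)
    (Finset.mem_univ (⟨0, hj⟩ : Fin j))
  exact le_trans (by exact_mod_cast ha _) h

theorem isLocalExponent_two : IsLocalExponent 2 1 := by
  refine ⟨2 ^ 2 ^ 2, by positivity, fun p hp j hj hj1 a ha => ?_⟩
  have : Fact p.Prime := ⟨hp⟩
  have hp1 : (1 : ℝ) ≤ p := by exact_mod_cast hp.one_le
  have hs := one_le_sum hj1 ha
  obtain ⟨N, rfl⟩ : ∃ N, j = N + 1 := ⟨j - 1, by omega⟩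
  refine (cardLE_hasDiagonal a ha).mono ?_
  have hN : (N : ℝ) ≤ 1 := by exact_mod_cast (by omega : N ≤ 1)
  gcongr
  · exact one_le_two
  · nlinarith

theorem isLocalExponent_of_four_le {k : ℕ} (hk : 4 ≤ k) :
    IsLocalExponent k ((k : ℝ) / 2 - 2 / 3) := by
  refine ⟨2 ^ k ^ 2, by positivity, fun p hp j hj hj1 a ha => ?_⟩
  have : Fact p.Prime := ⟨hp⟩
  have hp1 : (1 : ℝ) ≤ p := by exact_mod_cast hp.one_le
  have hs := one_le_sum hj1 ha
  obtain ⟨N, rfl⟩ : ∃ N, j = N + 1 := ⟨j - 1, by omega⟩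
  have hk' : (4 : ℝ) ≤ k := by exact_mod_cast hk
  rcases hj.eq_or_lt with rfl | hlt
  · exact cardLE_hasDiagonal_interpolated (by omega) a ha
  · refine (cardLE_hasDiagonal a ha).mono ?_
    -- Below the top dimension the quadratic bound suffices: `(k - 2)(Σ - 1) / 2` already has slope
    -- under `k / 2 - 2 / 3`, and `k ≥ 4` supplies the `- 1`.
    have hN : (N : ℝ) + 2 ≤ k := by exact_mod_cast (by omega : N + 2 ≤ k)
    gcongr
    · exact one_le_two
    · nlinarith

end Diagonal

/-! ### From subrings of index `p ^ e` to sublattices of `p ℤ ^ j`. -/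

section LocalStructure

variable {n k p : ℕ}

/-- The group `ℤⁿ / R` is generated by at most `k` elements. -/
def QuotientGeneratedBy (R : Subring (Fin n → ℤ)) (k : ℕ) : Prop :=
  ∃ r ≤ k, ∃ g : Fin r → Fin n → ℤ, ∀ z, ∃ c : Fin r → ℤ, z - ∑ i, c i • g i ∈ R

theorem CorankAtMost.quotientGeneratedBy {R : Subring (Fin n → ℤ)}
    (h : CorankAtMost R.toAddSubgroup k) : QuotientGeneratedBy R k := by
  obtain ⟨r, hr, α, -, -, ⟨e⟩⟩ := h
  have hlift : ∀ i : Fin r, ∃ x : Fin n → ℤ,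
      e (QuotientAddGroup.mk x) = Pi.single i (1 : ZMod (α i)) := fun i => by
    obtain ⟨x, hx⟩ := QuotientAddGroup.mk_surjective (e.symm (Pi.single i (1 : ZMod (α i))))
    exact ⟨x, by rw [hx, e.apply_symm_apply]⟩
  choose g hg using hlift
  refine ⟨r, hr, g, fun z => ?_⟩
  choose c hc using fun i => ZMod.intCast_surjective (e (QuotientAddGroup.mk z) i)
  refine ⟨c, ?_⟩
  have h0 : (QuotientAddGroup.mk (z - ∑ i, c i • g i) : (Fin n → ℤ) ⧸ R.toAddSubgroup) = 0 := by
    apply e.injective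
    let m : (Fin n → ℤ) →+ ((i : Fin r) → ZMod (α i)) :=
      (e : _ →+ _).comp (QuotientAddGroup.mk' R.toAddSubgroup)
    have hm : ∀ x, m x = e (QuotientAddGroup.mk x) := fun _ => rfl
    rw [map_zero, ← hm, map_sub, map_sum, sub_eq_zero]
    funext i
    rw [Finset.sum_apply, Finset.sum_eq_single i]
    · rw [map_zsmul, hm, hm, hg, Pi.smul_apply, Pi.single_eq_same, ← hc, zsmul_one]
    · intro l _ hl
      rw [map_zsmul, hm, hg, Pi.smul_apply, Pi.single_eq_of_ne hl.symm, smul_zero]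
    · simp
  exact (QuotientAddGroup.eq_zero_iff _).1 h0

/-- This monotonicity is why the corank is replaced by a number of generators: the condition passes
directly to the overrings `R + a ℤⁿ`. -/
theorem QuotientGeneratedBy.mono {R R' : Subring (Fin n → ℤ)} (h : QuotientGeneratedBy R k)
    (hR : R ≤ R') : QuotientGeneratedBy R' k := by
  obtain ⟨r, hr, g, hg⟩ := h
  exact ⟨r, hr, g, fun z => (hg z).imp fun c hc => hR hc⟩

theorem index_smul_mem (R : Subring (Fin n → ℤ)) (z : Fin n → ℤ) :
    (R.toAddSubgroup.index : ℤ) • z ∈ R := by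
  rw [natCast_zsmul]
  exact R.toAddSubgroup.nsmul_index_mem z

/-- `c` sends each coordinate to a representative of its class for the relation that identifies
coordinates which are congruent modulo `p` on all of `R`. -/
structure IsClassMap (p : ℕ) (R : Subring (Fin n → ℤ)) (c : Fin n → Fin n) : Prop where
  idem : ∀ i, c (c i) = c i
  dvd_sub : ∀ x ∈ R, ∀ i, (p : ℤ) ∣ x i - x (c i)
  comp_mem : ∀ z : Fin n → ℤ, z ∘ c ∈ R

/-- A product `Y` of separating elements of `R` vanishes off one class and is prime to `p` on it. By
Euler's theorem a suitable power of `Y` is congruent to the indicator of the class modulo `p ^ e ℤⁿ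
⊆ R`, so that indicator lies in `R`. -/
theorem exists_isClassMap [hp : Fact p.Prime] {R : Subring (Fin n → ℤ)} {e : ℕ}
    (hR : R.toAddSubgroup.index = p ^ e) : ∃ c, IsClassMap p R c := by
  classical
  have hpi : Prime (p : ℤ) := Nat.prime_iff_prime_int.1 hp.out
  let s : Setoid (Fin n) :=
    { r := fun i j => ∀ x ∈ R, (p : ℤ) ∣ x i - x j
      iseqv :=
        { refl := fun i x _ => by simp
          symm := fun h x hx => by rw [dvd_sub_comm]; exact h x hx
          trans := fun h h' x hx => by
            have := dvd_add (h x hx) (h' x hx)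
            rwa [sub_add_sub_cancel] at this } }
  let c : Fin n → Fin n := fun i => (Quotient.mk s i).out
  have hc : ∀ i, s (c i) i := fun i => Quotient.mk_out i
  have hcc : ∀ i j, s i j → c i = c j := fun i j h => by
    change (Quotient.mk s i).out = (Quotient.mk s j).out
    rw [Quotient.sound h]
  have hind : ∀ i, (fun l => if s l i then (1 : ℤ) else 0) ∈ R := by
    intro i
    have hsep : ∀ j, ∃ y ∈ R, ¬ s j i → y j = 0 ∧ ¬ (p : ℤ) ∣ y i := by
      intro j
      by_cases hj : s j i
      · exact ⟨0, R.zero_mem, fun h => absurd hj h⟩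
      · have hj' : ¬ ∀ x ∈ R, (p : ℤ) ∣ x j - x i := hj
        push Not at hj'
        obtain ⟨x, hx, hxp⟩ := hj'
        refine ⟨x - (x j) • 1, R.sub_mem hx (R.zsmul_mem R.one_mem _), fun _ => ⟨by simp, ?_⟩⟩
        rw [dvd_sub_comm] at hxp
        simpa using hxp
    choose y hyR hy using hsep
    let Y : Fin n → ℤ := ∏ j ∈ Finset.univ.filter (fun j => ¬ s j i), y j
    have hYR : Y ∈ R := R.prod_mem fun j _ => hyR j
    have hY0 : ∀ l, ¬ s l i → Y l = 0 := fun l hl => by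
      change (∏ j ∈ _, y j) l = 0
      rw [Finset.prod_apply]
      exact Finset.prod_eq_zero (by simpa using hl) (hy l hl).1
    have hYi : ¬ (p : ℤ) ∣ Y i := by
      change ¬ (p : ℤ) ∣ (∏ j ∈ _, y j) i
      rw [Finset.prod_apply, hpi.dvd_finsetProd_iff]
      rintro ⟨j, hj, hdvd⟩
      exact (hy j (by simpa using hj)).2 hdvd
    have hY1 : ∀ l, s l i → ¬ (p : ℤ) ∣ Y l := fun l hl h => by
      have := dvd_sub h (hl Y hYR)
      rw [sub_sub_cancel] at this
      exact hYi this
    let m := Nat.totient (p ^ e)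
    have hm : m ≠ 0 := (Nat.totient_pos.2 (pow_pos hp.out.pos e)).ne'
    have hdvd : ∀ l, ((p ^ e : ℕ) : ℤ) ∣ (if s l i then (1 : ℤ) else 0) - (Y ^ m) l := by
      intro l
      rw [Pi.pow_apply]
      by_cases hl : s l i
      · rw [if_pos hl]
        have hcop : IsCoprime (Y l) ((p ^ e : ℕ) : ℤ) := by
          push_cast
          exact ((hpi.coprime_iff_not_dvd).2 (hY1 l hl)).symm.pow_right
        have hu : IsUnit (Y l : ZMod (p ^ e)) := by
          obtain ⟨u, v, huv⟩ := hcop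
          refine IsUnit.of_mul_eq_one (u : ZMod (p ^ e)) ?_
          have := congrArg (Int.cast : ℤ → ZMod (p ^ e)) huv
          rw [Int.cast_add, Int.cast_mul, Int.cast_mul, Int.cast_natCast, ZMod.natCast_self,
            mul_zero, add_zero, Int.cast_one] at this
          rw [mul_comm, this]
        obtain ⟨u, hu⟩ := hu
        rw [← ZMod.intCast_eq_intCast_iff_dvd_sub]
        push_cast
        rw [← hu, ← Units.val_pow_eq_pow_val, ZMod.pow_totient, Units.val_one]
      · rw [if_neg hl, hY0 l hl, zero_pow hm]
        simp
    choose w hw using hdvd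
    have : (fun l => if s l i then (1 : ℤ) else 0) = Y ^ m + ((p ^ e : ℕ) : ℤ) • w := by
      funext l
      rw [Pi.add_apply, Pi.smul_apply, smul_eq_mul, ← hw]
      ring
    rw [this, ← hR]
    exact R.add_mem (R.pow_mem hYR m) (index_smul_mem R w)
  refine ⟨c, fun i => hcc _ _ (hc i), fun x hx i => s.symm (hc i) x hx, fun z => ?_⟩
  have hz : z ∘ c = ∑ i ∈ Finset.univ.filter (fun i => c i = i),
      z i • (fun l => if s l i then (1 : ℤ) else 0) := by
    funext l
    rw [Finset.sum_apply, Finset.sum_eq_single (c l)]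
    · simp [s.symm (hc l)]
    · intro i hi hil
      have hi' : c i = i := by simpa using hi
      have : ¬ s l i := fun h => hil (by rw [← hi', hcc l i h])
      simp [this]
    · intro h
      exact absurd (by simpa using hcc _ _ (hc l)) h
  rw [hz]
  exact R.sum_mem fun i _ => R.zsmul_mem (hind i) _

/-- The coordinates that are not fixed by `c`, as a number. -/
noncomputable def movedCard (c : Fin n → Fin n) : ℕ := Fintype.card {i // c i ≠ i}

/-- Extension by zero from the coordinates not fixed by `c`. -/
noncomputable def extendHom (c : Fin n → Fin n) : (Fin (movedCard c) → ℤ) →ₙ+* (Fin n → ℤ) where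
  toFun u i := if h : c i ≠ i then u (Fintype.equivFin {i // c i ≠ i} ⟨i, h⟩) else 0
  map_mul' u v := by
    funext i
    by_cases h : c i = i
    · simp [h]
    · simp only [ne_eq, h, not_false_eq_true, dite_true, Pi.mul_apply]
      rfl
  map_zero' := by
    funext i
    by_cases h : c i = i
    · simp [h]
    · simp only [ne_eq, h, not_false_eq_true, dite_true]
      rfl
  map_add' u v := by
    funext i
    by_cases h : c i = i
    · simp [h]
    · simp only [ne_eq, h, not_false_eq_true, dite_true, Pi.add_apply]
      rfl

theorem extendHom_of_ne (c : Fin n → Fin n) (u : Fin (movedCard c) → ℤ) {i : Fin n}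
    (h : c i ≠ i) : extendHom c u i = u (Fintype.equivFin {i // c i ≠ i} ⟨i, h⟩) :=
  dif_pos h

theorem extendHom_of_eq (c : Fin n → Fin n) (u : Fin (movedCard c) → ℤ) {i : Fin n}
    (h : c i = i) : extendHom c u i = 0 :=
  dif_neg (not_not.2 h)

/-- The coordinate of `ℤⁿ` that corresponds to `t`. -/
noncomputable def movedCoord (c : Fin n → Fin n) (t : Fin (movedCard c)) : {i // c i ≠ i} :=
  (Fintype.equivFin {i // c i ≠ i}).symm t

theorem extendHom_movedCoord (c : Fin n → Fin n) (u : Fin (movedCard c) → ℤ)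
    (t : Fin (movedCard c)) : extendHom c u (movedCoord c t) = u t := by
  rw [extendHom_of_ne c u (movedCoord c t).2]
  exact congrArg u (Equiv.apply_symm_apply _ t)

theorem exists_extendHom_eq (c : Fin n → Fin n) (z : Fin n → ℤ) :
    ∃ u, extendHom c u = z - z ∘ c := by
  refine ⟨fun t => z (movedCoord c t) - z (c (movedCoord c t)), ?_⟩
  funext i
  by_cases h : c i = i
  · rw [extendHom_of_eq c _ h]
    simp [h]
  · rw [extendHom_of_ne c _ h]
    simp [movedCoord]

/-- The elements of `R` that vanish at the coordinates fixed by `c`. -/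
noncomputable def movedPart (R : Subring (Fin n → ℤ)) (c : Fin n → Fin n) :
    NonUnitalSubring (Fin (movedCard c) → ℤ) :=
  R.toNonUnitalSubring.comap (extendHom c)

theorem mem_movedPart {R : Subring (Fin n → ℤ)} {c : Fin n → Fin n}
    {u : Fin (movedCard c) → ℤ} : u ∈ movedPart R c ↔ extendHom c u ∈ R := Iff.rfl

namespace IsClassMap

variable {R R' : Subring (Fin n → ℤ)} {c : Fin n → Fin n}

/-- Since `z = (z - z ∘ c) + z ∘ c` with `z ∘ c ∈ R`, the vectors supported on moved coordinates
surject onto `ℤⁿ / R`. -/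
theorem index_movedPart (h : IsClassMap p R c) :
    (movedPart R c).toAddSubgroup.index = R.toAddSubgroup.index := by
  let f : (Fin (movedCard c) → ℤ) →+ (Fin n → ℤ) := (extendHom c : _ →+ _)
  have h1 : (movedPart R c).toAddSubgroup = R.toAddSubgroup.comap f := rfl
  have h2 : f.range ⊔ R.toAddSubgroup = ⊤ := by
    refine eq_top_iff.2 fun z _ => ?_
    obtain ⟨u, hu⟩ := exists_extendHom_eq c z
    have : z = (z - z ∘ c) + z ∘ c := by abel
    rw [this]
    exact AddSubgroup.add_mem_sup ⟨u, hu⟩ (h.comp_mem z)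
  rw [h1, AddSubgroup.index_comap, ← AddSubgroup.relIndex_sup_right, h2,
    AddSubgroup.relIndex_top_right]

theorem dvd_of_mem_movedPart (h : IsClassMap p R c) {u : Fin (movedCard c) → ℤ}
    (hu : u ∈ movedPart R c) (t : Fin (movedCard c)) : (p : ℤ) ∣ u t := by
  have := h.dvd_sub _ hu (movedCoord c t)
  rwa [extendHom_movedCoord, extendHom_of_eq c u (h.idem _), sub_zero] at this

theorem le_of_movedPart_eq (h : IsClassMap p R c) (h' : IsClassMap p R' c)
    (hRR' : movedPart R c = movedPart R' c) : R ≤ R' := by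
  intro x hx
  obtain ⟨u, hu⟩ := exists_extendHom_eq c x
  have h1 : u ∈ movedPart R c := by
    rw [mem_movedPart, hu]
    exact R.sub_mem hx (h.comp_mem x)
  rw [hRR', mem_movedPart, hu] at h1
  simpa using R'.add_mem h1 (h'.comp_mem x)

/-- The differences `z i - z (c i)` modulo `p`, over moved `i`, map `ℤⁿ / R` onto a vector space
over `𝔽_p` whose dimension is the number of moved coordinates. -/
theorem movedCard_le [hp : Fact p.Prime] (h : IsClassMap p R c) (hk : QuotientGeneratedBy R k) :
    movedCard c ≤ k := by
  obtain ⟨r, hr, g, hg⟩ := hk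
  let q : (Fin n → ℤ) →+ (Fin (movedCard c) → ZMod p) :=
    { toFun := fun z t => ((z (movedCoord c t) - z (c (movedCoord c t)) : ℤ) : ZMod p)
      map_zero' := by funext t; simp
      map_add' := fun x y => by funext t; simp only [Pi.add_apply]; push_cast; ring }
  have hqR : ∀ x ∈ R, q x = 0 := fun x hx => by
    funext t
    exact (ZMod.intCast_zmod_eq_zero_iff_dvd _ _).2 (h.dvd_sub x hx _)
  have hspan : Submodule.span (ZMod p) (Set.range (q ∘ g)) = ⊤ := by
    refine eq_top_iff.2 fun v _ => ?_
    choose u hu using fun t => ZMod.intCast_surjective (v t)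
    obtain ⟨b, hb⟩ := hg (extendHom c u)
    have h1 : q (extendHom c u) = v := by
      funext t
      change ((extendHom c u (movedCoord c t) - extendHom c u (c (movedCoord c t)) : ℤ) : ZMod p) = _
      rw [extendHom_movedCoord, extendHom_of_eq c u (h.idem _), sub_zero, hu]
    have h2 := hqR _ hb
    rw [map_sub, sub_eq_zero, h1, map_sum] at h2
    rw [h2]
    refine Submodule.sum_mem _ fun i _ => ?_
    rw [map_zsmul]
    exact zsmul_mem (Submodule.subset_span (Set.mem_range_self i)) _
  have := finrank_range_le_card (R := ZMod p) (q ∘ g)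
  rw [Set.finrank, hspan, finrank_top, Module.finrank_fin_fun, Fintype.card_fin] at this
  exact this.trans hr

end IsClassMap

theorem cardLE_index_eq_prime_pow [hp : Fact p.Prime] {j e : ℕ} {B : ℝ} (hB : 0 ≤ B)
    (h : ∀ a : Fin j → ℕ, ∑ i, a i = e → (∀ i, 1 ≤ a i) → CardLE {S | HasDiagonal p j a S} B) :
    CardLE {S : NonUnitalSubring (Fin j → ℤ) | S.toAddSubgroup.index = p ^ e ∧
      ∀ x ∈ S, ∀ i, (p : ℤ) ∣ x i} (((e : ℝ) + 1) ^ j * B) := by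
  classical
  have hex : ∀ S : NonUnitalSubring (Fin j → ℤ), ∃ a : Fin j → ℕ,
      (S.toAddSubgroup.index = p ^ e ∧ ∀ x ∈ S, ∀ i, (p : ℤ) ∣ x i) →
        HasDiagonal p j a S ∧ ∑ i, a i = e ∧ ∀ i, 1 ≤ a i := by
    intro S
    by_cases hS : S.toAddSubgroup.index = p ^ e ∧ ∀ x ∈ S, ∀ i, (p : ℤ) ∣ x i
    · exact (hasDiagonal_exists hS.1 hS.2).imp fun a ha _ => ha
    · exact ⟨0, fun h => absurd h hS⟩
  choose a ha using hex
  refine CardLE.of_fibers (u := {b : Fin j → ℕ | ∑ i, b i = e ∧ ∀ i, 1 ≤ b i}) a ?_ (fun S hS => (ha S hS).2)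
    hB fun b hb => (h b hb.1 hb.2).subset ?_
  · refine ((CardLE.of_finset (Fintype.piFinset fun _ : Fin j => Finset.range (e + 1))).subset
      fun b hb => ?_).mono ?_
    · simp only [Fintype.coe_piFinset, Set.mem_pi, Finset.coe_range, Set.mem_Iio]
      intro i _
      rw [Nat.lt_succ_iff, ← hb.1]
      exact Finset.single_le_sum (fun _ _ => Nat.zero_le _) (Finset.mem_univ i)
    · simp
  · rintro S ⟨hS, rfl⟩
    exact (ha S hS).1

/-- The subrings of index `m` whose quotient is generated by `k` elements. -/
def subringsOfIndex (n k m : ℕ) : Set (Subring (Fin n → ℤ)) :=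
  {R | R.toAddSubgroup.index = m ∧ QuotientGeneratedBy R k}

theorem IsLocalExponent.cardLE_prime_pow {s : ℝ} (hs : IsLocalExponent k s) (n : ℕ) :
    ∃ D : ℝ, 0 ≤ D ∧ ∀ p : ℕ, p.Prime → ∀ e : ℕ, 1 ≤ e →
      CardLE (subringsOfIndex n k (p ^ e))
        (D * ((e : ℝ) + 1) ^ k * (p : ℝ) ^ (s * e - 1)) := by
  classical
  obtain ⟨D, hD, h⟩ := hs
  refine ⟨(n : ℝ) ^ n * D, by positivity, fun p hp e he => ?_⟩
  have : Fact p.Prime := ⟨hp⟩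
  have hex : ∀ R : Subring (Fin n → ℤ), ∃ c : Fin n → Fin n,
      R.toAddSubgroup.index = p ^ e → IsClassMap p R c := fun R => by
    by_cases hR : R.toAddSubgroup.index = p ^ e
    · exact (exists_isClassMap hR).imp fun c hc _ => hc
    · exact ⟨id, fun h => absurd h hR⟩
  choose c hc using hex
  have huniv : CardLE (Set.univ : Set (Fin n → Fin n)) ((n : ℝ) ^ n) :=
    ((CardLE.of_finset (Finset.univ : Finset (Fin n → Fin n))).subset (by simp)).mono (by simp)
  have hbase : (1 : ℝ) ≤ (e : ℝ) + 1 := by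
    have : (0 : ℝ) ≤ e := e.cast_nonneg
    linarith
  have key := CardLE.of_fibers (s := subringsOfIndex n k (p ^ e))
    (B := ((e : ℝ) + 1) ^ k * (D * (p : ℝ) ^ (s * e - 1))) c huniv
    (fun _ _ => Set.mem_univ _) (by positivity) (fun d _ => by
      rcases Set.eq_empty_or_nonempty {R ∈ subringsOfIndex n k (p ^ e) | c R = d} with
        h0 | ⟨R₀, h₀, h₀d⟩
      · rw [h0]
        exact ⟨Set.finite_empty, by rw [Set.ncard_empty, Nat.cast_zero]; positivity⟩
      · have hcl := hc R₀ h₀.1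
        rw [h₀d] at hcl
        have hjk : movedCard d ≤ k := hcl.movedCard_le h₀.2
        -- Dimension `0` must be excluded because the local bound carries a factor `p⁻¹`; there the
        -- index would be `1`, not `p ^ e`.
        have hj1 : 1 ≤ movedCard d := by
          by_contra hlt
          have hzero : movedCard d = 0 := by omega
          have hidx := hcl.index_movedPart
          have : IsEmpty (Fin (movedCard d)) := by rw [hzero]; infer_instance
          have htop : (movedPart R₀ d).toAddSubgroup = ⊤ := by
            ext x
            rw [Subsingleton.elim x 0]
            exact iff_of_true (zero_mem _) (zero_mem _)
          rw [htop, AddSubgroup.index_top, h₀.1] at hidx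
          rcases Nat.pow_eq_one.1 hidx.symm with h1 | h1
          · exact hp.one_lt.ne' h1
          · omega
        refine (CardLE.of_injOn (fun R => movedPart R d) (cardLE_index_eq_prime_pow (p := p)
          (j := movedCard d) (e := e) (B := D * (p : ℝ) ^ (s * e - 1)) (by positivity)
          fun a ha ha1 => ?_) ?_ ?_).mono ?_
        · have := h p hp _ hjk hj1 a ha1
          rwa [← Nat.cast_sum, ha] at this
        · rintro R ⟨hR, rfl⟩
          have hcR := hc R hR.1
          exact ⟨hcR.index_movedPart.trans hR.1, fun x hx => hcR.dvd_of_mem_movedPart hx⟩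
        · rintro R ⟨hR, hRd⟩ R' ⟨hR', hRd'⟩ hRR'
          have h1 := hc R hR.1
          have h2 := hc R' hR'.1
          rw [hRd] at h1
          rw [hRd'] at h2
          exact le_antisymm (h1.le_of_movedPart_eq h2 hRR') (h2.le_of_movedPart_eq h1 hRR'.symm)
        · gcongr)
  exact key.mono (le_of_eq (by ring))

end LocalStructure

/-! ### Splitting over coprime indices. -/

section Multiplicativity

variable {n k : ℕ}

/-- The subring `R + a ℤⁿ`. -/
def Subring.addMultiples (R : Subring (Fin n → ℤ)) (a : ℕ) : Subring (Fin n → ℤ) where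
  carrier := {x | ∃ z : Fin n → ℤ, x + (a : ℤ) • z ∈ R}
  mul_mem' := by
    rintro x y ⟨z, hz⟩ ⟨w, hw⟩
    refine ⟨x * w + z * y + (a : ℤ) • (z * w), ?_⟩
    convert R.mul_mem hz hw using 1
    funext i
    simp only [Pi.add_apply, Pi.mul_apply, Pi.smul_apply, smul_eq_mul]
    ring
  one_mem' := ⟨0, by simp⟩
  add_mem' := by
    rintro x y ⟨z, hz⟩ ⟨w, hw⟩
    refine ⟨z + w, ?_⟩
    convert R.add_mem hz hw using 1
    rw [smul_add]
    abel
  zero_mem' := ⟨0, by simp⟩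
  neg_mem' := by
    rintro x ⟨z, hz⟩
    refine ⟨-z, ?_⟩
    convert R.neg_mem hz using 1
    rw [smul_neg, neg_add]

theorem Subring.mem_addMultiples {R : Subring (Fin n → ℤ)} {a : ℕ} {x : Fin n → ℤ} :
    x ∈ R.addMultiples a ↔ ∃ z : Fin n → ℤ, x + (a : ℤ) • z ∈ R := Iff.rfl

theorem Subring.le_addMultiples (R : Subring (Fin n → ℤ)) (a : ℕ) : R ≤ R.addMultiples a :=
  fun _ hx => ⟨0, by simpa using hx⟩

theorem Subring.smul_mem_addMultiples (R : Subring (Fin n → ℤ)) (a : ℕ) (z : Fin n → ℤ) :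
    (a : ℤ) • z ∈ R.addMultiples a :=
  ⟨-z, by simp⟩

variable {R : Subring (Fin n → ℤ)} {a b : ℕ}

theorem addMultiples_inf_addMultiples (hab : a.Coprime b)
    (hR : R.toAddSubgroup.index = a * b) : R.addMultiples a ⊓ R.addMultiples b = R := by
  refine le_antisymm ?_ (le_inf (R.le_addMultiples a) (R.le_addMultiples b))
  rintro x ⟨⟨z, hz⟩, ⟨w, hw⟩⟩
  obtain ⟨u, v, huv⟩ := Nat.isCoprime_iff_coprime.2 hab
  have h1 : ∀ y : Fin n → ℤ, ((a : ℤ) * b) • y ∈ R := fun y => by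
    have := index_smul_mem R y
    rwa [hR, Nat.cast_mul] at this
  have h2 : x = (v * b) • (x + (a : ℤ) • z) + (u * a) • (x + (b : ℤ) • w) -
      ((a : ℤ) * b) • (v • z + u • w) := by
    funext i
    simp only [Pi.add_apply, Pi.sub_apply, Pi.smul_apply, smul_eq_mul]
    linear_combination -x i * huv
  rw [h2]
  exact R.sub_mem (R.add_mem (R.zsmul_mem hz _) (R.zsmul_mem hw _)) (h1 _)

/-- The quotient by `R + a ℤⁿ` is killed by `a`, so by Cauchy's theorem every prime dividing its
order divides `a`. The order is thus prime to `b`, while it divides `a * b`. -/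
theorem index_addMultiples_dvd (ha : a ≠ 0) (hb : b ≠ 0) (hab : a.Coprime b)
    (hR : R.toAddSubgroup.index = a * b) : (R.addMultiples a).toAddSubgroup.index ∣ a := by
  have h1 : (R.addMultiples a).toAddSubgroup.index ∣ a * b :=
    hR ▸ AddSubgroup.index_dvd_of_le (R.le_addMultiples a)
  refine Nat.Coprime.dvd_of_dvd_mul_right ?_ h1
  rw [Nat.coprime_iff_gcd_eq_one]
  by_contra hne
  obtain ⟨q, hq, hqd⟩ := Nat.exists_prime_and_dvd hne
  have hq1 := hqd.trans (Nat.gcd_dvd_left _ _)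
  have hq2 := hqd.trans (Nat.gcd_dvd_right _ _)
  have : Fact q.Prime := ⟨hq⟩
  have hne0 : (R.addMultiples a).toAddSubgroup.index ≠ 0 :=
    ne_zero_of_dvd_ne_zero (mul_ne_zero ha hb) h1
  have : (R.addMultiples a).toAddSubgroup.FiniteIndex := ⟨hne0⟩
  have : Finite ((Fin n → ℤ) ⧸ (R.addMultiples a).toAddSubgroup) := inferInstance
  obtain ⟨x, hx⟩ := exists_prime_addOrderOf_dvd_card' (G := (Fin n → ℤ) ⧸
    (R.addMultiples a).toAddSubgroup) q hq1
  obtain ⟨x, rfl⟩ := QuotientAddGroup.mk_surjective x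
  have hax : a • (QuotientAddGroup.mk x : (Fin n → ℤ) ⧸ (R.addMultiples a).toAddSubgroup) = 0 := by
    rw [← QuotientAddGroup.mk_nsmul, QuotientAddGroup.eq_zero_iff, ← natCast_zsmul]
    exact R.smul_mem_addMultiples a x
  have hqa : q ∣ a := hx ▸ addOrderOf_dvd_of_nsmul_eq_zero hax
  exact hq.one_lt.ne' (Nat.dvd_one.1 (hab ▸ Nat.dvd_gcd hqa hq2))

/-- The two overrings have indices at most `a` and `b` and intersect in `R`, of index `a * b`, so
neither inequality can be strict. -/
theorem index_addMultiples (ha : a ≠ 0) (hb : b ≠ 0) (hab : a.Coprime b)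
    (hR : R.toAddSubgroup.index = a * b) : (R.addMultiples a).toAddSubgroup.index = a := by
  have h1 := Nat.le_of_dvd (Nat.pos_of_ne_zero ha) (index_addMultiples_dvd ha hb hab hR)
  have h2 := Nat.le_of_dvd (Nat.pos_of_ne_zero hb)
    (index_addMultiples_dvd hb ha hab.symm (by rw [hR, mul_comm]))
  have h3 : a * b ≤ (R.addMultiples a).toAddSubgroup.index *
      (R.addMultiples b).toAddSubgroup.index := by
    have hinf : R.toAddSubgroup =
        (R.addMultiples a).toAddSubgroup ⊓ (R.addMultiples b).toAddSubgroup :=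
      congrArg Subring.toAddSubgroup (addMultiples_inf_addMultiples hab hR).symm
    rw [← hR, hinf]
    exact AddSubgroup.index_inf_le
  by_contra hne
  have hlt := lt_of_le_of_ne h1 hne
  have := Nat.mul_lt_mul_of_lt_of_le hlt h2 (Nat.pos_of_ne_zero hb)
  omega

theorem CardLE.subringsOfIndex_mul {A B : ℝ} (ha : a ≠ 0) (hb : b ≠ 0) (hab : a.Coprime b)
    (hA : CardLE (subringsOfIndex n k a) A) (hB : CardLE (subringsOfIndex n k b) B) :
    CardLE (subringsOfIndex n k (a * b)) (A * B) := by
  refine CardLE.of_fibers (fun R => R.addMultiples a) hA (fun R hR => ?_) hB.nonneg fun S _ => ?_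
  · exact ⟨index_addMultiples ha hb hab hR.1, hR.2.mono (R.le_addMultiples a)⟩
  · refine CardLE.of_injOn (fun R => R.addMultiples b) hB ?_ ?_
    · rintro R ⟨hR, -⟩
      exact ⟨index_addMultiples hb ha hab.symm (by rw [hR.1, mul_comm]),
        hR.2.mono (R.le_addMultiples b)⟩
    · rintro R ⟨hR, h1⟩ R' ⟨hR', h2⟩ h
      rw [← addMultiples_inf_addMultiples hab hR.1, ← addMultiples_inf_addMultiples hab hR'.1]
      exact congrArg₂ (· ⊓ ·) (h1.trans h2.symm) h

theorem cardLE_subringsOfIndex_one : CardLE (subringsOfIndex n k 1) 1 := by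
  refine CardLE.of_subsingleton fun R hR R' hR' => ?_
  exact Subring.toAddSubgroup_injective
    ((AddSubgroup.index_eq_one.1 hR.1).trans (AddSubgroup.index_eq_one.1 hR'.1).symm)

theorem cardLE_subringsOfIndex_factorization_prod {g : ℕ → ℕ → ℝ} (hg0 : ∀ p, g p 0 = 1)
    (hg : ∀ p : ℕ, p.Prime → ∀ e : ℕ, 1 ≤ e → CardLE (subringsOfIndex n k (p ^ e)) (g p e))
    (m : ℕ) (hm : m ≠ 0) : CardLE (subringsOfIndex n k m) (m.factorization.prod g) := by
  induction m using Nat.recOnPosPrimePosCoprime with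
  | prime_pow p e hp he =>
    rw [hp.factorization_pow, Finsupp.prod_single_index (hg0 p)]
    exact hg p hp e he
  | zero => exact absurd rfl hm
  | one => simpa using cardLE_subringsOfIndex_one
  | coprime a b ha hb hab iha ihb =>
    have ha0 : a ≠ 0 := by omega
    have hb0 : b ≠ 0 := by omega
    rw [Nat.factorization_mul_of_coprime hab,
      Finsupp.prod_add_index_of_disjoint hab.disjoint_primeFactors]
    exact CardLE.subringsOfIndex_mul ha0 hb0 hab (iha ha0) (ihb hb0)

end Multiplicativity

/-! ### Euler product and Rankin's trick. -/

section DirichletSeries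

/-- Every positive `m < N` is `N`-smooth, so the partial sum is at most the Euler product over `p <
N`, whose factors are at most `1 + v p * U ≤ exp (v p * U)`. -/
theorem sum_range_le_of_multiplicative {f : ℕ → ℝ} (hf : ∀ m, 0 ≤ f m) (hf0 : f 0 = 0)
    (hf1 : f 1 = 1) (hmul : ∀ {a b : ℕ}, a.Coprime b → f (a * b) = f a * f b) {u v : ℕ → ℝ}
    (hu : Summable u) (hu0 : ∀ e, 0 ≤ u e) (hv : Summable v) (hv0 : ∀ p, 0 ≤ v p)
    (h : ∀ p : ℕ, p.Prime → ∀ e, f (p ^ (e + 1)) ≤ v p * u e) :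
    ∃ K : ℝ, ∀ N : ℕ, ∑ m ∈ Finset.range N, f m ≤ K := by
  set U := ∑' e, u e
  have hU : 0 ≤ U := tsum_nonneg hu0
  have hsum1 : ∀ p : ℕ, p.Prime → Summable fun e => f (p ^ (e + 1)) := fun p hp =>
    Summable.of_nonneg_of_le (fun _ => hf _) (h p hp) (hu.mul_left (v p))
  have hsum : ∀ p : ℕ, p.Prime → Summable fun e => f (p ^ e) := fun p hp =>
    (summable_nat_add_iff 1).1 (hsum1 p hp)
  have hfac : ∀ p : ℕ, p.Prime → ∑' e, f (p ^ e) ≤ Real.exp (v p * U) := fun p hp => by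
    rw [(hsum p hp).tsum_eq_zero_add, pow_zero, hf1]
    have h1 : ∑' e, f (p ^ (e + 1)) ≤ v p * U := by
      rw [← tsum_mul_left]
      exact (hsum1 p hp).tsum_le_tsum (h p hp) (hu.mul_left (v p))
    have h2 := Real.add_one_le_exp (v p * U)
    linarith
  refine ⟨Real.exp (∑' p, v p * U), fun N => ?_⟩
  have hE := (EulerProduct.summable_and_hasSum_smoothNumbers_prod_primesBelow_tsum hf1 hmul
    (fun {p} hp => by simpa only [Real.norm_of_nonneg (hf _)] using hsum p hp) N).2
  have hE' := hasSum_subtype_iff_indicator.1 hE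
  have hle : ∑ m ∈ Finset.range N, f m ≤
      ∑ m ∈ Finset.range N, (N.smoothNumbers).indicator f m := by
    refine Finset.sum_le_sum fun m hm => ?_
    rcases Nat.eq_zero_or_pos m with rfl | hpos
    · rw [hf0]
      exact Set.indicator_nonneg (fun x _ => hf x) 0
    · rw [Set.indicator_of_mem (Nat.mem_smoothNumbers_of_lt hpos (Finset.mem_range.1 hm))]
  refine hle.trans ((sum_le_hasSum _ (fun m _ => Set.indicator_nonneg (fun x _ => hf x) m)
    hE').trans ?_)
  calc ∏ p ∈ N.primesBelow, ∑' e, f (p ^ e)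
      ≤ ∏ p ∈ N.primesBelow, Real.exp (v p * U) :=
        Finset.prod_le_prod (fun p _ => tsum_nonneg fun _ => hf _)
          fun p hp => hfac p (Nat.prime_of_mem_primesBelow hp)
    _ = Real.exp (∑ p ∈ N.primesBelow, v p * U) := (Real.exp_sum _ _).symm
    _ ≤ _ := Real.exp_le_exp.2 ((hv.mul_right U).sum_le_tsum _
        fun p _ => mul_nonneg (hv0 p) hU)

variable {n k : ℕ}

/-- Rankin's trick: each index `m < X` satisfies `m ^ t ≤ X ^ t`. -/
theorem subringCount_le_sum {F : ℕ → ℝ}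
    (hF : ∀ m, m ≠ 0 → CardLE (subringsOfIndex n k m) (F m)) {f : ℕ → ℝ} {t X : ℝ} (ht : 0 ≤ t)
    (hf0 : f 0 = 0) (hf : ∀ m, 0 ≤ f m) (hFf : ∀ m, m ≠ 0 → F m = f m * (m : ℝ) ^ t) :
    (subringCount n k X : ℝ) ≤ X ^ t * ∑ m ∈ Finset.range ⌈X⌉₊, f m := by
  classical
  have hfin := corankSubrings_finite n k X
  have hmaps : ∀ R ∈ hfin.toFinset, R.toAddSubgroup.index ∈ Finset.range ⌈X⌉₊ := fun R hR => by
    have hR' : R ∈ corankSubrings n k X := by simpa using hR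
    rw [Finset.mem_range, Nat.lt_ceil]
    exact hR'.2.1
  rw [subringCount, Set.ncard_eq_toFinset_card _ hfin, Finset.card_eq_sum_card_fiberwise hmaps,
    Nat.cast_sum, Finset.mul_sum]
  refine Finset.sum_le_sum fun m hm => ?_
  have hmX : (m : ℝ) < X := Nat.lt_ceil.1 (Finset.mem_range.1 hm)
  rcases Nat.eq_zero_or_pos m with rfl | hpos
  · rw [hf0, mul_zero, Finset.card_eq_zero.2, Nat.cast_zero]
    refine Finset.filter_eq_empty_iff.2 fun R hR h0 => ?_
    have hR' : R ∈ corankSubrings n k X := by simpa using hR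
    exact hR'.1 h0
  · have hsub : CardLE ((hfin.toFinset.filter fun R => R.toAddSubgroup.index = m : Finset _) :
        Set (Subring (Fin n → ℤ))) (F m) := by
      refine (hF m hpos.ne').subset fun R hR => ?_
      rw [Finset.mem_coe, Finset.mem_filter, Set.Finite.mem_toFinset] at hR
      exact ⟨hR.2, CorankAtMost.quotientGeneratedBy hR.1.2.2⟩
    have h1 := hsub.2
    rw [Set.ncard_coe_finset, hFf m hpos.ne', mul_comm] at h1
    refine h1.trans (mul_le_mul_of_nonneg_right ?_ (hf m))
    exact Real.rpow_le_rpow (Nat.cast_nonneg _) hmX.le ht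

theorem IsLocalExponent.subringCount_isBigO {s : ℝ} (hs : IsLocalExponent k s) (hs0 : 0 ≤ s)
    (n : ℕ) {ε : ℝ} (hε : 0 < ε) :
    (fun X : ℝ => (subringCount n k X : ℝ)) =O[atTop] fun X : ℝ => X ^ (s + ε) := by
  obtain ⟨D, hD, hloc⟩ := hs.cardLE_prime_pow n
  let g : ℕ → ℕ → ℝ := fun p e =>
    if e = 0 then 1 else D * ((e : ℝ) + 1) ^ k * (p : ℝ) ^ (s * e - 1)
  have hg : ∀ p e, 0 ≤ g p e := fun p e => by
    dsimp only [g]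
    split_ifs
    · exact zero_le_one
    · positivity
  have hg0 : ∀ p, g p 0 = 1 := fun p => if_pos rfl
  let F : ℕ → ℝ := fun m => m.factorization.prod g
  have hF : ∀ m, m ≠ 0 → CardLE (subringsOfIndex n k m) (F m) :=
    cardLE_subringsOfIndex_factorization_prod hg0 fun p hp e he => by
      have : e ≠ 0 := by omega
      simpa only [g, this, if_false] using hloc p hp e he
  have ht : 0 < s + ε := by linarith
  let f : ℕ → ℝ := fun m => if m = 0 then 0 else F m * ((m : ℝ) ^ (s + ε))⁻¹
  have hf : ∀ m, 0 ≤ f m := fun m => by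
    dsimp only [f]
    split_ifs
    · exact le_rfl
    · exact mul_nonneg (Finset.prod_nonneg fun _ _ => hg _ _) (by positivity)
  have hf0 : f 0 = 0 := if_pos rfl
  have hf1 : f 1 = 1 := by simp [f, F]
  have hmul : ∀ {a b : ℕ}, a.Coprime b → f (a * b) = f a * f b := by
    intro a b hab
    by_cases ha : a = 0
    · simp [ha, hf0]
    by_cases hb : b = 0
    · simp [hb, hf0]
    have hFm : F (a * b) = F a * F b := by
      simp only [F]
      rw [Nat.factorization_mul_of_coprime hab,
        Finsupp.prod_add_index_of_disjoint hab.disjoint_primeFactors]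
    simp only [f, mul_eq_zero, ha, hb, or_self, if_false, hFm]
    rw [Nat.cast_mul, Real.mul_rpow (Nat.cast_nonneg _) (Nat.cast_nonneg _), mul_inv]
    ring
  -- The largest value of `p ^ (-ε)` over primes, giving a geometric ratio uniform in `p`.
  let r : ℝ := (2 : ℝ) ^ (-ε)
  have hr0 : 0 < r := by positivity
  have hr1 : r < 1 := Real.rpow_lt_one_of_one_lt_of_neg one_lt_two (by linarith)
  have hu : Summable fun e : ℕ => D * ((e : ℝ) + 2) ^ k * r ^ e := by
    have h1 : Summable fun e : ℕ => ((e + 2 : ℕ) : ℝ) ^ k * r ^ (e + 2) :=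
      (summable_nat_add_iff 2).2 (summable_pow_mul_geometric_of_norm_lt_one k
      (r := r) (by rwa [Real.norm_of_nonneg hr0.le]))
    refine (h1.mul_left (D * (r ^ 2)⁻¹)).congr fun e => ?_
    push_cast
    rw [pow_add]
    field_simp
  have hv : Summable fun p : ℕ => (p : ℝ) ^ (-1 - ε) := Real.summable_nat_rpow.2 (by linarith)
  obtain ⟨K, hK⟩ := sum_range_le_of_multiplicative hf hf0 hf1 hmul hu (fun e => by positivity) hv
    (fun p => by positivity) (fun p hp e => by
      have hp0 : (0 : ℝ) < p := by exact_mod_cast hp.pos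
      have hpe : p ^ (e + 1) ≠ 0 := pow_ne_zero _ hp.ne_zero
      have hFp : F (p ^ (e + 1)) = D * ((e : ℝ) + 2) ^ k * (p : ℝ) ^ (s * (e + 1) - 1) := by
        simp only [F]
        rw [hp.factorization_pow, Finsupp.prod_single_index (hg0 p)]
        simp only [g, Nat.succ_ne_zero, if_false]
        push_cast
        ring_nf
      have hpow : (p : ℝ) ^ (s * (e + 1) - 1) * (((p ^ (e + 1) : ℕ) : ℝ) ^ (s + ε))⁻¹ =
          (p : ℝ) ^ (-1 - ε) * ((p : ℝ) ^ (-ε)) ^ e := by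
        push_cast
        rw [← Real.rpow_natCast, ← Real.rpow_natCast, ← Real.rpow_mul hp0.le,
          ← Real.rpow_mul hp0.le, ← Real.rpow_neg hp0.le, ← Real.rpow_add hp0,
          ← Real.rpow_add hp0]
        congr 1
        push_cast
        ring
      have hle : (p : ℝ) ^ (-ε) ≤ r :=
        Real.rpow_le_rpow_of_nonpos two_pos (by exact_mod_cast hp.two_le) (by linarith)
      have hff : f (p ^ (e + 1)) = F (p ^ (e + 1)) * (((p ^ (e + 1) : ℕ) : ℝ) ^ (s + ε))⁻¹ :=
        if_neg hpe
      rw [hff, hFp, mul_assoc, hpow]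
      calc D * ((e : ℝ) + 2) ^ k * ((p : ℝ) ^ (-1 - ε) * ((p : ℝ) ^ (-ε)) ^ e)
          ≤ D * ((e : ℝ) + 2) ^ k * ((p : ℝ) ^ (-1 - ε) * r ^ e) := by gcongr
        _ = _ := by ring)
  refine IsBigO.of_bound K ?_
  filter_upwards [eventually_ge_atTop 0] with X hX
  have hFf : ∀ m, m ≠ 0 → F m = f m * (m : ℝ) ^ (s + ε) := fun m hm => by
    have : (0 : ℝ) < (m : ℝ) ^ (s + ε) :=
      Real.rpow_pos_of_pos (by exact_mod_cast Nat.pos_of_ne_zero hm) _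
    simp only [f, hm, if_false]
    rw [inv_mul_cancel_right₀ this.ne']
  rw [Real.norm_of_nonneg (Nat.cast_nonneg _), Real.norm_of_nonneg (Real.rpow_nonneg hX _),
    mul_comm]
  exact (subringCount_le_sum hF ht.le hf0 hf hFf).trans
    (mul_le_mul_of_nonneg_left (hK _) (Real.rpow_nonneg hX _))

end DirichletSeries

theorem subringCount_mono (n : ℕ) {k l : ℕ} (hkl : k ≤ l) (X : ℝ) :
    subringCount n k X ≤ subringCount n l X := by
  refine Set.ncard_le_ncard ?_ (corankSubrings_finite n l X)
  rintro R ⟨h0, hX, r, hr, h⟩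
  exact ⟨h0, hX, r, hr.trans hkl, h⟩

theorem IsLocalExponent.tendsto_subringCount_div {k l : ℕ} {s b : ℝ} (hs : IsLocalExponent l s)
    (hs0 : 0 ≤ s) (hkl : k ≤ l) (hb : s < b) (n : ℕ) :
    Tendsto (fun X : ℝ => (subringCount n k X : ℝ) / X ^ b) atTop (𝓝 0) := by
  -- Half the gap `b - s` is spent on `ε`; the other half gives decay.
  have h1 := hs.subringCount_isBigO hs0 n (ε := (b - s) / 2) (by linarith)
  have h2 : (fun X : ℝ => (subringCount n k X : ℝ)) =O[atTop] fun X : ℝ => X ^ (s + (b - s) / 2) :=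
    (IsBigO.of_bound 1 (Eventually.of_forall fun X => by
      rw [one_mul, Real.norm_of_nonneg (Nat.cast_nonneg _),
        Real.norm_of_nonneg (Nat.cast_nonneg _)]
      exact_mod_cast subringCount_mono n hkl X)).trans h1
  have h3 : (fun X : ℝ => X ^ (s + (b - s) / 2)) =o[atTop] fun X : ℝ => X ^ b := by
    refine (isLittleO_iff_tendsto' ?_).2 ?_
    · filter_upwards [eventually_gt_atTop 0] with X hX h
      exact absurd h (Real.rpow_pos_of_pos hX b).ne'
    · refine (tendsto_rpow_neg_atTop (y := (b - s) / 2) (by linarith)).congr' ?_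
      filter_upwards [eventually_gt_atTop 0] with X hX
      rw [← Real.rpow_sub hX]
      congr 1
      ring
  exact (h2.trans_isLittleO h3).tendsto_div_nhds_zero

/-! ### Lower bound for `a(n)`. -/

section Exponent

/-- With `x = n - 1`, one has `d (x - d) + 1 - (3 - 2√2) x (x + d) = 1 - (x + d - √2 x) ^ 2`. The
summand `1` in the numerator thus absorbs the rounding of the real optimum `d = (√2 - 1) x`. -/
theorem ishamExponent_ge_of_dist_le_one {n d : ℕ} (hd : d < n) (hn : 2 ≤ n)
    (h1 : ((n : ℝ) - 1 + d - Real.sqrt 2 * ((n : ℝ) - 1)) ^ 2 ≤ 1) :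
    (3 - 2 * Real.sqrt 2) * ((n : ℝ) - 1) ≤ ishamExponent n := by
  have hn' : (2 : ℝ) ≤ n := by exact_mod_cast hn
  have hd0 : (0 : ℝ) ≤ d := d.cast_nonneg
  have hs : Real.sqrt 2 ^ 2 = 2 := Real.sq_sqrt (by norm_num)
  have hpos : 0 < (n : ℝ) - 1 + d := by linarith
  refine le_trans ?_ (le_ciSup (Set.finite_range _).bddAbove (⟨d, hd⟩ : Fin n))
  rw [← add_div, le_div_iff₀ hpos]
  change _ ≤ (d : ℝ) * ((n : ℝ) - 1 - d) + 1
  have h2 : (d : ℝ) * ((n : ℝ) - 1 - d) + 1 -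
      (3 - 2 * Real.sqrt 2) * ((n : ℝ) - 1) * ((n : ℝ) - 1 + d) =
        1 - ((n : ℝ) - 1 + d - Real.sqrt 2 * ((n : ℝ) - 1)) ^ 2 := by
    linear_combination ((n : ℝ) - 1) ^ 2 * hs
  linarith

theorem ishamExponent_ge {n : ℕ} (hn : 2 ≤ n) :
    (3 - 2 * Real.sqrt 2) * ((n : ℝ) - 1) ≤ ishamExponent n := by
  have hn' : (2 : ℝ) ≤ n := by exact_mod_cast hn
  have hs1 : 1 ≤ Real.sqrt 2 := Real.one_le_sqrt.2 one_le_two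
  have hs2 : Real.sqrt 2 < 2 := by
    rw [Real.sqrt_lt' (by norm_num)]
    norm_num
  have hx : 0 ≤ (Real.sqrt 2 - 1) * ((n : ℝ) - 1) := by
    apply mul_nonneg <;> linarith
  have hle := Nat.floor_le hx
  have hlt := Nat.lt_floor_add_one ((Real.sqrt 2 - 1) * ((n : ℝ) - 1))
  refine ishamExponent_ge_of_dist_le_one (d := ⌊(Real.sqrt 2 - 1) * ((n : ℝ) - 1)⌋₊) ?_ hn ?_
  · have : (⌊(Real.sqrt 2 - 1) * ((n : ℝ) - 1)⌋₊ : ℝ) < n := by nlinarith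
    exact_mod_cast this
  · rw [sq_le_one_iff_abs_le_one, abs_le]
    constructor <;> linarith

end Exponent

/-! ### The main theorem. -/

theorem mainTheorem3 :
    (∀ n k : ℕ, 1 ≤ n → 4 ≤ k → ∀ ε : ℝ, 0 < ε →
      (fun X : ℝ => (subringCount n k X : ℝ)) =O[atTop]
        (fun X : ℝ => X ^ ((k : ℝ) / 2 - 2 / 3 + ε))) ∧
    (∀ n k : ℕ, 7 ≤ n →
      (k : ℝ) ≤ (6 - 4 * Real.sqrt 2) * (n : ℝ) + 2 * Real.sqrt 2 - 8 / 3 →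
      Tendsto (fun X : ℝ => (subringCount n k X : ℝ) / X ^ ishamExponent n) atTop (𝓝 0)) := by
  constructor
  · intro n k _ hk ε hε
    have hk' : (4 : ℝ) ≤ k := by exact_mod_cast hk
    exact (isLocalExponent_of_four_le hk).subringCount_isBigO (by linarith) n hε
  · intro n k hn hk
    have hn' : (7 : ℝ) ≤ n := by exact_mod_cast hn
    have ha := ishamExponent_ge (n := n) (by omega)
    have hs1 : 1.4142 < Real.sqrt 2 := Real.lt_sqrt_of_sq_lt (by norm_num)
    have hs2 : Real.sqrt 2 < 1.41422 := by
      rw [Real.sqrt_lt' (by norm_num)]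
      norm_num
    rcases le_or_gt k 2 with h2 | h2
    -- Exponent `1` suffices since `6 (3 - 2√2) > 1`; this uses `n ≥ 7`.
    · exact isLocalExponent_two.tendsto_subringCount_div zero_le_one h2 (by nlinarith) n
    rcases le_or_gt 4 k with h4 | h4
    · have hk' : (4 : ℝ) ≤ k := by exact_mod_cast h4
      exact (isLocalExponent_of_four_le h4).tendsto_subringCount_div (by linarith) le_rfl
        (by nlinarith) n
    -- Corank `3` is counted within corank `4`, with exponent `4 / 3`. The hypothesis on `k` forces
    -- `n ≥ 9`, and `8 (3 - 2√2) > 4 / 3`.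
    · obtain rfl : k = 3 := by omega
      have hn9 : (9 : ℝ) ≤ n := by
        have : 8 < n := by
          by_contra hlt
          have : (n : ℝ) ≤ 8 := by exact_mod_cast not_lt.1 hlt
          push_cast at hk
          nlinarith
        exact_mod_cast this
      exact (isLocalExponent_of_four_le le_rfl).tendsto_subringCount_div (by norm_num)
        (by norm_num) (by push_cast; nlinarith) n
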